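/- For a field $L$ let $K^M_*(L)=\bigoplus_{n\ge 0}K^M_n(L)$ denote its Milnor K-ring, i.e. the tensor ring of the abelian group $L^\times$ over $\mathbb Z$ modulo the two-sided ideal generated by the elements $a\otimes(1-a)$, $a\in L\setminus\{0,1\}$, graded so that $L^\times$ has degree $1$. Theorem 9. Let $E/F$ be a finite separable extension of fields of degree $k$. Assume that $F$ has no nontrivial finite extensions of degree less than or equal to $k/2$. Then $K^M_{\ge 1}(E)=\bigoplus_{n\ge 1}K^M_n(E)$, viewed as a graded module over $K^M_*(F)$ via the ring homomorphism $K^M_*(F)\to K^M_*(E)$, is a quadratic module, i.e. it is generated in degree $1$ with relations in degree $2$: the multiplication map $K^M_*(F)\otimes_{\mathbb Z}K^M_1(E)\to K^M_{\ge1}(E)$ is surjective, and its kernel is generated, as a $K^M_*(F)$-submodule, by its elements of degree $2$, that is, by its elements lying in $K^M_1(F)\otimes_{\mathbb Z}K^M_1(E)$. -/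

import Mathlib

open scoped TensorProduct DirectSum

universe u v

/-- The Steinberg relations in the tensor ring `T_ℤ(Fˣ)` of the (additively written) multiplicative
group of a field: `a ⊗ b = 0` whenever `a + b = 1` in `F`. -/
inductive MilnorK.Rel (F : Type*) [Field F] :
    TensorAlgebra ℤ (Additive Fˣ) → TensorAlgebra ℤ (Additive Fˣ) → Prop
  | steinberg (a b : Fˣ) (h : (a : F) + (b : F) = 1) :
      MilnorK.Rel F
        (TensorAlgebra.ι ℤ (Additive.ofMul a) * TensorAlgebra.ι ℤ (Additive.ofMul b)) 0

/-- The Milnor K-ring `K^M_*(F)` of a field: the tensor ring of `Fˣ` over `ℤ` modulo the two-sided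
ideal generated by the elements `a ⊗ (1 - a)`, for `a ≠ 0, 1`. -/
def MilnorK (F : Type*) [Field F] : Type _ := RingQuot (MilnorK.Rel F)

namespace MilnorK

noncomputable section

instance instRing (F : Type*) [Field F] : Ring (MilnorK F) :=
  inferInstanceAs (Ring (RingQuot (MilnorK.Rel F)))

/-- The quotient map from the tensor ring to the Milnor K-ring. -/
def mk (F : Type*) [Field F] : TensorAlgebra ℤ (Additive Fˣ) →+* MilnorK F :=
  RingQuot.mkRingHom (MilnorK.Rel F)

/-- The symbol map `a ↦ {a}`, as a homomorphism of abelian groups `Fˣ → K^M_*(F)`. -/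
def symbol (F : Type*) [Field F] : Additive Fˣ →+ MilnorK F :=
  (mk F).toAddMonoidHom.comp (TensorAlgebra.ι ℤ (M := Additive Fˣ)).toAddMonoidHom

theorem symbol_mul_symbol {F : Type*} [Field F] (a b : Fˣ) (h : (a : F) + (b : F) = 1) :
    symbol F (Additive.ofMul a) * symbol F (Additive.ofMul b) = 0 := by
  have := RingQuot.mkRingHom_rel (Rel.steinberg a b h)
  rw [map_mul, map_zero] at this
  exact this

/-- The universal property of the Milnor K-ring: a homomorphism from `Fˣ` to the additive group of
a ring that satisfies the Steinberg relations extends to the Milnor K-ring. -/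
def lift {F : Type*} [Field F] {S : Type*} [Ring S] (f : Additive Fˣ →+ S)
    (hf : ∀ a b : Fˣ, (a : F) + (b : F) = 1 →
      f (Additive.ofMul a) * f (Additive.ofMul b) = 0) : MilnorK F →+* S :=
  RingQuot.lift ⟨(TensorAlgebra.lift ℤ f.toIntLinearMap).toRingHom, by
    rintro _ _ ⟨a, b, h⟩
    simpa using hf a b h⟩

theorem lift_symbol {F : Type*} [Field F] {S : Type*} [Ring S] (f : Additive Fˣ →+ S)
    (hf : ∀ a b : Fˣ, (a : F) + (b : F) = 1 →
      f (Additive.ofMul a) * f (Additive.ofMul b) = 0) (x : Additive Fˣ) :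
    lift f hf (symbol F x) = f x := by
  have h : lift f hf (symbol F x) =
      (TensorAlgebra.lift ℤ f.toIntLinearMap).toRingHom (TensorAlgebra.ι ℤ x) :=
    RingQuot.lift_mkRingHom_apply _ _ _
  rw [h]
  simp

theorem hom_ext {F : Type*} [Field F] {S : Type*} [Ring S] {f g : MilnorK F →+* S}
    (h : ∀ x, f (symbol F x) = g (symbol F x)) : f = g := by
  refine RingQuot.ringQuot_ext f g ?_
  have : (f.comp (mk F)).toIntAlgHom = (g.comp (mk F)).toIntAlgHom := by
    apply TensorAlgebra.hom_ext
    ext x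
    exact h x
  ext x
  exact DFunLike.congr_fun this x

/-- The ring homomorphism `K^M_*(F) → K^M_*(E)`, `{a} ↦ {φ a}`, induced by `φ : F → E`. -/
def map {F : Type*} {E : Type*} [Field F] [Field E] (φ : F →+* E) : MilnorK F →+* MilnorK E :=
  lift ((symbol E).comp (Units.map (φ : F →* E)).toAdditive) fun a b h =>
    symbol_mul_symbol (Units.map (φ : F →* E) a) (Units.map (φ : F →* E) b) (by
      simp only [Units.coe_map, MonoidHom.coe_coe]
      rw [← map_add, h, map_one])

theorem map_symbol {F : Type*} {E : Type*} [Field F] [Field E] (φ : F →+* E) (a : Fˣ) :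
    map φ (symbol F (Additive.ofMul a)) =
      symbol E (Additive.ofMul (Units.map (φ : F →* E) a)) :=
  lift_symbol _ _ _

/-- The homogeneous component `K^M_n(F)`: the subgroup of `K^M_*(F)` generated by the products
`{a₁} ⋯ {aₙ}` of `n` symbols. -/
def component (F : Type*) [Field F] (n : ℕ) : Submodule ℤ (MilnorK F) :=
  LinearMap.range (symbol F).toIntLinearMap ^ n

/-- `K^M_0(F)` is the image of `ℤ`. -/
theorem component_zero (F : Type*) [Field F] : component F 0 = 1 := pow_zero _

theorem symbol_mem (F : Type*) [Field F] (x : Additive Fˣ) : symbol F x ∈ component F 1 := by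
  rw [component, pow_one]
  exact ⟨x, rfl⟩

instance instGradedMonoid (F : Type*) [Field F] : SetLike.GradedMonoid (component F) :=
  Submodule.nat_power_gradedMonoid _

/-- The homomorphism sending an element to the family of its homogeneous components. -/
def toComponents (F : Type*) [Field F] : MilnorK F →+* ⨁ n, component F n :=
  lift ((DirectSum.of (fun n => component F n) 1).comp
    (AddMonoidHom.codRestrict (symbol F) (component F 1) (symbol_mem F))) fun a b h => by
      simp only [AddMonoidHom.comp_apply]
      rw [DirectSum.of_mul_of]
      have : ∀ z : component F (1 + 1), (z : MilnorK F) = 0 →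
          DirectSum.of (fun n => component F n) (1 + 1) z = 0 := by
        intro z hz
        rw [Subtype.ext (a1 := z) (a2 := 0) hz, map_zero]
      exact this _ (symbol_mul_symbol a b h)

theorem toComponents_symbol (F : Type*) [Field F] (x : Additive Fˣ) :
    toComponents F (symbol F x) =
      DirectSum.of (fun n => component F n) 1 ⟨symbol F x, symbol_mem F x⟩ :=
  lift_symbol _ _ _

/-- `K^M_*(F)` is the direct sum of the groups `K^M_n(F)`, and a graded ring. -/
instance instGradedAlgebra (F : Type*) [Field F] : GradedAlgebra (component F) :=
  GradedAlgebra.ofAlgHom (component F) (toComponents F).toIntAlgHom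
    (by
      have : (DirectSum.coeRingHom (component F)).comp (toComponents F) = RingHom.id _ := by
        apply hom_ext
        intro x
        simp [toComponents_symbol]
      ext x
      exact DFunLike.congr_fun this x)
    (by
      intro n x
      obtain ⟨x, hx⟩ := x
      change toComponents F x = DirectSum.of _ n ⟨x, hx⟩
      induction hx using Submodule.pow_induction_on_left' with
      | algebraMap r =>
        have hr : toComponents F (algebraMap ℤ (MilnorK F) r) =
            algebraMap ℤ (⨁ n, component F n) r := by
          rw [eq_intCast, map_intCast, eq_intCast]
        exact hr
      | add x y i hx hy ihx ihy =>
        rw [map_add, ihx, ihy, ← map_add]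
        rfl
      | mem_mul m hm i x hx ih =>
        obtain ⟨a, rfl⟩ := hm
        rw [map_mul, ih]
        change toComponents F (symbol F a) * _ = _
        rw [toComponents_symbol, DirectSum.of_mul_of]
        apply DirectSum.of_eq_of_gradedMonoid_eq
        exact Sigma.subtype_ext (Nat.add_comm 1 i) rfl)

theorem map_mem {F : Type*} {E : Type*} [Field F] [Field E] (φ : F →+* E) {n : ℕ} {x : MilnorK F}
    (hx : x ∈ component F n) : map φ x ∈ component E n := by
  have h : (component F n).map (map φ).toIntAlgHom.toLinearMap ≤ component E n := by
    rw [component, Submodule.map_pow]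
    refine pow_le_pow_left' ?_ n
    rintro _ ⟨_, ⟨a, rfl⟩, rfl⟩
    exact ⟨Additive.ofMul (Units.map (φ : F →* E) a.toMul), (map_symbol φ a.toMul).symm⟩
  exact h ⟨x, hx, rfl⟩

/-- For a field extension `E/F`, the group `K^M_{≥1}(E) = ⨁_{n ≥ 1} K^M_n(E)`, that is, the kernel
of the projection of `K^M_*(E)` to degree zero, to be viewed as a module over `K^M_*(F)`. -/
def Pos (F E : Type*) [Field F] [Field E] [Algebra F E] : Type _ :=
  (HomogeneousIdeal.irrelevant (component E)).toIdeal

instance instAddCommGroupPos (F E : Type*) [Field F] [Field E] [Algebra F E] :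
    AddCommGroup (Pos F E) :=
  inferInstanceAs (AddCommGroup (HomogeneousIdeal.irrelevant (component E)).toIdeal)

/-- `K^M_*(F)` acts on `K^M_{≥1}(E)` by left multiplication through `K^M_*(F) → K^M_*(E)`. -/
instance instModulePos (F E : Type*) [Field F] [Field E] [Algebra F E] :
    Module (MilnorK F) (Pos F E) :=
  letI : Module (MilnorK E) (Pos F E) :=
    inferInstanceAs (Module (MilnorK E) (HomogeneousIdeal.irrelevant (component E)).toIdeal)
  Module.compHom (Pos F E) (map (algebraMap F E))

/-- The inclusion of `K^M_{≥1}(E)` in `K^M_*(E)`. -/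
def Pos.incl (F E : Type*) [Field F] [Field E] [Algebra F E] : Pos F E →+ MilnorK E :=
  (HomogeneousIdeal.irrelevant (component E)).toIdeal.subtype.toAddMonoidHom

theorem Pos.incl_injective (F E : Type*) [Field F] [Field E] [Algebra F E] :
    Function.Injective (Pos.incl F E) := Subtype.val_injective

theorem Pos.incl_smul {F E : Type*} [Field F] [Field E] [Algebra F E] (a : MilnorK F)
    (x : Pos F E) : Pos.incl F E (a • x) = map (algebraMap F E) a * Pos.incl F E x := rfl

/-- The grading of `K^M_{≥1}(E)`: the component of degree `n` is `K^M_n(E)` for `n ≥ 1`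
(and it is zero for `n = 0`). -/
def Pos.component (F E : Type*) [Field F] [Field E] [Algebra F E] (n : ℕ) :
    Submodule ℤ (Pos F E) :=
  (MilnorK.component E n).comap (Pos.incl F E).toIntLinearMap

theorem Pos.mem_component {F E : Type*} [Field F] [Field E] [Algebra F E] {n : ℕ} {x : Pos F E} :
    x ∈ Pos.component F E n ↔ Pos.incl F E x ∈ MilnorK.component E n := Iff.rfl

instance Pos.instGradedSMul (F E : Type*) [Field F] [Field E] [Algebra F E] :
    SetLike.GradedSMul (MilnorK.component F) (Pos.component F E) where
  smul_mem := fun _ _ _ _ ha hx =>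
    SetLike.GradedMul.mul_mem (A := MilnorK.component E) (map_mem (algebraMap F E) ha) hx

/-- The inclusion of `K^M_n(E)`, for `n ≥ 1`, as the summand of degree `n` of `K^M_{≥1}(E)`. -/
def Pos.ofComponent (F E : Type*) [Field F] [Field E] [Algebra F E] (n : ℕ) :
    MilnorK.component E n →+ ⨁ n, Pos.component F E n :=
  if hn : n = 0 then 0 else
    (DirectSum.of (fun n => Pos.component F E n) n).comp
      { toFun := fun y => ⟨⟨y, HomogeneousIdeal.mem_irrelevant_of_mem (MilnorK.component E)
          (Nat.pos_of_ne_zero hn) y.2⟩, y.2⟩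
        map_zero' := rfl
        map_add' := fun _ _ => rfl }

theorem Pos.component_zero {F E : Type*} [Field F] [Field E] [Algebra F E] (x : Pos F E)
    (hx : x ∈ Pos.component F E 0) : x = 0 := by
  apply Pos.incl_injective F E
  have h0 : (DirectSum.decompose (MilnorK.component E) (Pos.incl F E x) 0 : MilnorK E) = 0 := x.2
  rw [DirectSum.decompose_of_mem_same _ (Pos.mem_component.mp hx)] at h0
  rw [h0, map_zero]

/-- `K^M_{≥1}(E)` is the direct sum of its homogeneous components. -/
instance Pos.instDecomposition (F E : Type*) [Field F] [Field E] [Algebra F E] :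
    DirectSum.Decomposition (Pos.component F E) :=
  DirectSum.Decomposition.ofAddHom (Pos.component F E)
    (((DirectSum.toAddMonoid (Pos.ofComponent F E)).comp
      (DirectSum.decomposeAddEquiv (MilnorK.component E)).toAddMonoidHom).comp (Pos.incl F E))
    (by
      ext x
      apply Pos.incl_injective F E
      have key : ∀ z : ⨁ n, MilnorK.component E n, (z 0 : MilnorK E) = 0 →
          Pos.incl F E (DirectSum.coeAddMonoidHom (Pos.component F E)
            (DirectSum.toAddMonoid (Pos.ofComponent F E) z)) =
          DirectSum.coeAddMonoidHom (MilnorK.component E) z := by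
        classical
        intro z hz
        rw [← DirectSum.sum_support_of z]
        simp only [map_sum]
        refine Finset.sum_congr rfl fun i hi => ?_
        have hi0 : i ≠ 0 := by
          rintro rfl
          exact (DFinsupp.mem_support_iff.mp hi) (Subtype.ext hz)
        rw [DirectSum.toAddMonoid_of, Pos.ofComponent, dif_neg hi0, AddMonoidHom.comp_apply,
          DirectSum.coeAddMonoidHom_of, DirectSum.coeAddMonoidHom_of]
        rfl
      have h1 := key (DirectSum.decompose (MilnorK.component E) (Pos.incl F E x)) x.2
      have h2 : DirectSum.coeAddMonoidHom (MilnorK.component E)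
          (DirectSum.decompose (MilnorK.component E) (Pos.incl F E x)) = Pos.incl F E x :=
        (DirectSum.decompose (MilnorK.component E)).symm_apply_apply _
      exact h1.trans h2)
    (by
      refine DirectSum.addHom_ext' fun n => AddMonoidHom.ext fun x => ?_
      have : DirectSum.toAddMonoid (Pos.ofComponent F E)
          (DirectSum.decompose (MilnorK.component E) (Pos.incl F E x)) =
          DirectSum.of (fun n => Pos.component F E n) n x := by
        rw [DirectSum.decompose_of_mem _ (Pos.mem_component.mp x.2), DirectSum.toAddMonoid_of]
        by_cases hn : n = 0
        · subst hn
          have hx : x = 0 := Subtype.ext (Pos.component_zero x.1 x.2)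
          subst hx
          rw [map_zero]
          exact map_zero _
        · rw [Pos.ofComponent, dif_neg hn]
          rfl
      simp only [AddMonoidHom.comp_apply, DirectSum.coeAddMonoidHom_of]
      exact this)

end

end MilnorK

/-- For a graded `R`-algebra `A` and a graded left `A`-module `M`, the homomorphism of left
`A`-modules `A ⊗_R M₁ → M`, `a ⊗ m ↦ a m`, from the `A`-module induced from the component of
degree `1` of `M`. -/
noncomputable def degreeOneAction {R A M : Type*} [CommRing R] [Ring A] [Algebra R A]
    [AddCommGroup M] [Module R M] [Module A M] [IsScalarTower R A M] (ℳ : ℕ → Submodule R M) :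
    A ⊗[R] (ℳ 1) →ₗ[A] M :=
  TensorProduct.AlgebraTensorModule.lift
    (LinearMap.toSpanSingleton A (ℳ 1 →ₗ[R] M) (ℳ 1).subtype)

theorem degreeOneAction_tmul {R A M : Type*} [CommRing R] [Ring A] [Algebra R A]
    [AddCommGroup M] [Module R M] [Module A M] [IsScalarTower R A M] (ℳ : ℕ → Submodule R M)
    (a : A) (m : ℳ 1) : degreeOneAction ℳ (a ⊗ₜ[R] m) = a • (m : M) := by
  simp [degreeOneAction]

/-- Let `A` be a nonnegatively graded ring whose component of degree `0` is (the image of) the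
commutative ring `R`, and let `M` be a graded left `A`-module. `M` is *quadratic* if it is generated
in degree `1` with relations in degree `2`: the homomorphism `A ⊗_R M₁ → M` is surjective, and its
kernel is generated, as an `A`-submodule, by its elements of degree `2`, that is, by those
which lie in (the image of) `A₁ ⊗_R M₁`. -/
structure IsQuadraticModule {R A M : Type*} [CommRing R] [Ring A] [Algebra R A]
    [AddCommGroup M] [Module R M] [Module A M] [IsScalarTower R A M]
    (𝒜 : ℕ → Submodule R A) [GradedAlgebra 𝒜]
    (ℳ : ℕ → Submodule R M) [DirectSum.Decomposition ℳ] [SetLike.GradedSMul 𝒜 ℳ] : Prop where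
  generated_in_degree_one : Function.Surjective (degreeOneAction (A := A) ℳ)
  relations_in_degree_two : LinearMap.ker (degreeOneAction (A := A) ℳ) =
    Submodule.span A {z | degreeOneAction (A := A) ℳ z = 0 ∧
      z ∈ LinearMap.range (TensorProduct.map (𝒜 1).subtype (LinearMap.id (R := R) (M := ℳ 1)))}

namespace MilnorK

/-! ### Identities between symbols and the universal property of the positive part -/

section Symbols
variable {L : Type*} [Field L]

/-! Write `E = F(θ)`. A dimension count shows that every nonzero element of `E` is `p(θ)/q(θ)` with
`p`, `q` of degree at most `k/2`, and by hypothesis such polynomials split over `F`. Hence `Eˣ` is a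
quotient of the group `G` of split rational functions, with kernel `N`. A relation `a + b = 1` in
`E` lifts to `p/q + (q - p)/q = 1` in `F(X)`, again between split functions (`exists_splitEval_eq`).

Let `R` be the subring of `K^M_*(F(X))` generated by the symbols of `G`. The lifted Steinberg
relations give a ring map from `K^M_*(E)` to `R/({n} : n ∈ N)`. The ring `R` is understood over
`K^M_*(F)`: the identity for `{X - a}{X - b}` rewrites products of two symbols with one factor
constant (`exists_degreeTwo_eq_mul`), and residues show that the `{X - a}` are independent
(`exists_const_of_extendedAction_ratFunc_eq_zero`).

A relation over `E` therefore lifts to an element of `K^M_*(F) ⊗ G` whose image lies in the ideal of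
`N`. That image has another lift, built from degree-two relations
(`exists_lift_of_mem_symbolIdeal`). The two lifts differ by a relation among constants, which is
quadratic because `K^M_*(F)` itself has quadratic relations (`mk_lTensor_eq_zero`). -/

theorem closure_range_symbol (L : Type*) [Field L] :
    Subring.closure (Set.range (symbol L)) = ⊤ := by
  set S := Subring.closure (Set.range (symbol L))
  -- The composite of this map with the inclusion of `S` fixes all symbols, so it is the identity.
  let g : MilnorK L →+* S := lift
    (AddMonoidHom.codRestrict (symbol L) S fun x => Subring.subset_closure ⟨x, rfl⟩)
    (fun a b h => Subtype.ext (symbol_mul_symbol a b h))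
  have hg : S.subtype.comp g = RingHom.id _ := hom_ext fun x => by
    change ((g (symbol L x) : S) : MilnorK L) = symbol L x
    rw [show g (symbol L x) = _ from lift_symbol _ _ x]
    rfl
  refine eq_top_iff.mpr fun x _ => ?_
  have h := DFunLike.congr_fun hg x
  change ((g x : S) : MilnorK L) = x at h
  exact h ▸ (g x).2

/-- An additive subgroup that contains `1` and is stable under right multiplication by the elements
of `s` contains the subring generated by `s`. -/
theorem mem_of_mem_subringClosure {R : Type*} [Ring R] {s : Set R} (V : AddSubgroup R)
    (h1 : (1 : R) ∈ V) (hV : ∀ v ∈ V, ∀ x ∈ s, v * x ∈ V) {y : R}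
    (hy : y ∈ Subring.closure s) : y ∈ V := by
  suffices h : ∀ v ∈ V, v * y ∈ V by simpa using h 1 h1
  induction hy using Subring.closure_induction with
  | mem y hy => exact fun v hv => hV v hv y hy
  | zero => exact fun v _ => by simp
  | one => exact fun v hv => by simpa using hv
  | add x y _ _ hx hy => exact fun v hv => by rw [mul_add]; exact V.add_mem (hx v hv) (hy v hv)
  | neg x _ hx => exact fun v hv => by rw [mul_neg]; exact V.neg_mem (hx v hv)
  | mul x y _ _ hx hy => exact fun v hv => by rw [← mul_assoc]; exact hy _ (hx v hv)

theorem mem_of_mul_symbol_mem (V : AddSubgroup (MilnorK L)) (h1 : (1 : MilnorK L) ∈ V)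
    (hV : ∀ v ∈ V, ∀ x, v * symbol L x ∈ V) (y : MilnorK L) : y ∈ V := by
  refine mem_of_mem_subringClosure V h1 (s := Set.range (symbol L)) ?_ ?_
  · rintro v hv _ ⟨x, rfl⟩
    exact hV v hv x
  · rw [closure_range_symbol]
    trivial

/-- For `a ≠ 1` one has `-a = (1 - a)/(1 - a⁻¹)`, and `{a}` annihilates both `{1 - a}` and `{1 -
a⁻¹}`. -/
theorem symbol_mul_symbol_neg (a : Lˣ) :
    symbol L (Additive.ofMul a) * symbol L (Additive.ofMul (-a)) = 0 := by
  by_cases ha : a = 1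
  · subst ha
    rw [ofMul_one, map_zero, zero_mul]
  have ha' : (a : L) ≠ 1 := fun h => ha (Units.ext h)
  have hi : ((a⁻¹ : Lˣ) : L) ≠ 1 := fun h => ha (inv_eq_one.mp (Units.ext h))
  let b : Lˣ := Units.mk0 (1 - (a : L)) (sub_ne_zero.mpr ha'.symm)
  let c : Lˣ := Units.mk0 (1 - ((a⁻¹ : Lˣ) : L)) (sub_ne_zero.mpr hi.symm)
  have hb := symbol_mul_symbol a b (by simp [b])
  have hc := symbol_mul_symbol a⁻¹ c (by simp [c])
  have hbc : -a * c = b := by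
    ext
    simp only [b, c, Units.val_mul, Units.val_neg, Units.val_mk0, mul_sub, mul_one, neg_mul,
      Units.mul_inv]
    ring
  rw [ofMul_inv, map_neg, neg_mul, neg_eq_zero] at hc
  rw [← hbc, ofMul_mul, map_add, mul_add, hc, add_zero] at hb
  exact hb

theorem symbol_neg (a : Lˣ) : symbol L (Additive.ofMul (-a)) =
    symbol L (Additive.ofMul (-1)) + symbol L (Additive.ofMul a) := by
  rw [← map_add, ← ofMul_mul, neg_one_mul]

/-- Polarization of `{z}{-z} = 0`: expand it at the product of the two units and subtract the two
individual identities. -/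
theorem symbol_anticomm (x y : Additive Lˣ) :
    symbol L x * symbol L y = -(symbol L y * symbol L x) := by
  have key : ∀ z : Additive Lˣ, symbol L z * symbol L (Additive.ofMul (-1)) +
      symbol L z * symbol L z = 0 := fun z => by
    have := symbol_mul_symbol_neg z.toMul
    rwa [symbol_neg, mul_add] at this
  have h1 := key (x + y)
  have h2 := key x
  have h3 := key y
  simp only [map_add, add_mul, mul_add] at h1
  rw [eq_neg_iff_add_eq_zero, ← h1]
  rw [add_eq_zero_iff_eq_neg] at h2 h3
  rw [h2, h3]
  abel

theorem symbol_mul_self (x : Additive Lˣ) :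
    symbol L x * symbol L x = symbol L (Additive.ofMul (-1)) * symbol L x := by
  have h := symbol_mul_symbol_neg x.toMul
  rw [symbol_neg, mul_add, symbol_anticomm _ (Additive.ofMul (-1))] at h
  exact (neg_add_eq_zero.mp h).symm

theorem two_symbol_neg_one : symbol L (Additive.ofMul (-1)) + symbol L (Additive.ofMul (-1)) = 0 := by
  rw [← map_add, ← ofMul_mul, neg_one_mul, neg_neg, ofMul_one, map_zero]

/-- The relation in `K^M_2` coming from `x - y = c`. -/
theorem symbol_mul_symbol_of_sub_eq {x y c : Lˣ} (h : (x : L) - y = c) :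
    (symbol L (Additive.ofMul x) - symbol L (Additive.ofMul c)) *
      (symbol L (Additive.ofMul y) - symbol L (Additive.ofMul (-c))) = 0 := by
  have hd : ∀ a b : Lˣ, symbol L (Additive.ofMul a) - symbol L (Additive.ofMul b) =
      symbol L (Additive.ofMul (a / b)) := fun a b => by rw [ofMul_div, map_sub]
  rw [hd, hd]
  apply symbol_mul_symbol
  have hc : (c : L) ≠ 0 := c.ne_zero
  simp only [Units.val_div_eq_div_val, Units.val_neg]
  rw [div_neg, ← sub_eq_add_neg, ← sub_div, h, div_self hc]

theorem map_map {L₁ L₂ L₃ : Type*} [Field L₁] [Field L₂] [Field L₃] (φ : L₁ →+* L₂)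
    (ψ : L₂ →+* L₃) (x : MilnorK L₁) : map ψ (map φ x) = map (ψ.comp φ) x := by
  have : (map ψ).comp (map φ) = map (ψ.comp φ) := hom_ext fun x => by
    change map ψ (map φ (symbol L₁ (Additive.ofMul x.toMul))) =
      map (ψ.comp φ) (symbol L₁ (Additive.ofMul x.toMul))
    simp only [map_symbol]
    rfl
  exact DFunLike.congr_fun this x

/-- The degree one part of `K^M_{≥1}(F)`, with its relations of degree two: a homomorphism from
`Fˣ` to a left `K^M_*(F)`-module `U` that satisfies the Steinberg relations extends to a map defined
on `K^M_{≥1}(F)`. -/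
theorem exists_addMonoidHom_mul_symbol {F U : Type*} [Field F] [AddCommGroup U]
    [Module (MilnorK F) U] (h : Additive Fˣ →+ U)
    (hh : ∀ a b : Fˣ, (a : F) + (b : F) = 1 →
      symbol F (Additive.ofMul a) • h (Additive.ofMul b) = 0) :
    ∃ Ψ : MilnorK F →+ U, ∀ y f, Ψ (y * symbol F f) = y • h f := by
  -- Right multiplication by `{f}` is made to act on pairs, the first entry remembering the element
  -- reached so far. Right actions compose in reverse, hence the opposite ring. The second entry of
  -- `(1, 0)` acted on by `y` is `Ψ y`.
  let m : Additive Fˣ → AddMonoid.End (MilnorK F × U) := fun f =>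
    { toFun := fun v => (v.1 * symbol F f, v.1 • h f)
      map_zero' := by simp
      map_add' := fun v w => by simp [add_mul, add_smul] }
  let r : Additive Fˣ →+ (AddMonoid.End (MilnorK F × U))ᵐᵒᵖ := AddMonoidHom.mk'
    (fun f => MulOpposite.op (m f))
    (fun f g => by
      apply MulOpposite.unop_injective
      ext v : 1
      change (v.1 * symbol F (f + g), v.1 • h (f + g)) =
        (v.1 * symbol F f, v.1 • h f) + (v.1 * symbol F g, v.1 • h g)
      rw [map_add, map_add, mul_add, smul_add, Prod.mk_add_mk])
  have hr : ∀ f v, (r f).unop v = (v.1 * symbol F f, v.1 • h f) := fun _ _ => rfl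
  let Θ : MilnorK F →+* (AddMonoid.End (MilnorK F × U))ᵐᵒᵖ := lift r fun a b hab => by
    apply MulOpposite.unop_injective
    ext v : 1
    change (r (Additive.ofMul b)).unop ((r (Additive.ofMul a)).unop v) = 0
    rw [hr, hr]
    ext
    · simp [mul_assoc, symbol_mul_symbol a b hab]
    · simp [mul_smul, hh a b hab]
  have hΘs : ∀ f, Θ (symbol F f) = r f := lift_symbol _ _
  have hΘm : ∀ y z v, (Θ (y * z)).unop v = (Θ z).unop ((Θ y).unop v) := fun y z v => by
    rw [map_mul]
    rfl
  let Φ : MilnorK F →+ MilnorK F × U := AddMonoidHom.mk' (fun y => (Θ y).unop (1, 0))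
    (fun y z => by rw [map_add]; rfl)
  have hΦ : ∀ y f, Φ (y * symbol F f) = ((Φ y).1 * symbol F f, (Φ y).1 • h f) := fun y f => by
    change (Θ _).unop _ = _
    rw [hΘm, hΘs, hr]
    rfl
  have hΦ1 : ∀ y, (Φ y).1 = y := by
    let V : AddSubgroup (MilnorK F) :=
      ((AddMonoidHom.fst _ _).comp Φ - AddMonoidHom.id _).ker
    have hV : ∀ y, y ∈ V ↔ (Φ y).1 = y := fun y => by
      simp [V, AddMonoidHom.mem_ker, sub_eq_zero]
    intro y
    rw [← hV]
    refine mem_of_mul_symbol_mem V ?_ ?_ y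
    · rw [hV]
      change ((Θ 1).unop (1, 0)).1 = 1
      rw [map_one]
      rfl
    · intro v hv x
      rw [hV] at hv ⊢
      rw [hΦ, hv]
  exact ⟨(AddMonoidHom.snd _ _).comp Φ, fun y f => by simp [hΦ, hΦ1]⟩

end Symbols
end MilnorK

namespace MilnorK

/-! ### Specialization and residue for Laurent series -/

section Residue
variable {F : Type*} [Field F]

/-- The automorphism of `K^M_*(F)` that is `(-1)^n` on `K^M_n(F)`. -/
noncomputable def signInvolution (F : Type*) [Field F] : MilnorK F →+* MilnorK F :=
  lift (-symbol F) fun a b h => by simp [symbol_mul_symbol a b h]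

theorem signInvolution_symbol (x : Additive Fˣ) :
    signInvolution F (symbol F x) = -symbol F x := lift_symbol _ _ x

/-- Matrices describing the right multiplication by `{u} + i ξ` on the left `K^M_*(F)`-module with
basis `1, ξ`, where `ξ² = {-1} ξ`. -/
noncomputable def residueMatrix (F : Type*) [Field F] :
    Additive Fˣ × ℤ →+ Matrix (Fin 2) (Fin 2) (MilnorK F) :=
  -- The rows are the images of `1` and `ξ`, where `ξ` plays the role of `{T}`: `ξ{u} = -{u}ξ` and
  -- `ξ · iξ = i{-1}ξ`.
  AddMonoidHom.mk' (fun p => !![symbol F p.1, (p.2 : MilnorK F);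
      0, p.2 • symbol F (Additive.ofMul (-1)) - symbol F p.1]) fun p q => by
    ext i j
    fin_cases i <;> fin_cases j <;> simp [add_smul]
    abel

theorem residueMatrix_apply (u : Additive Fˣ) (i : ℤ) :
    residueMatrix F (u, i) = !![symbol F u, (i : MilnorK F);
      0, i • symbol F (Additive.ofMul (-1)) - symbol F u] := rfl

theorem residueMatrix_mul_of_add_eq_one (a b : Fˣ) (h : (a : F) + b = 1) :
    residueMatrix F (Additive.ofMul a, 0) * residueMatrix F (Additive.ofMul b, 0) = 0 := by
  simp only [residueMatrix_apply, Matrix.mul_fin_two]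
  ext i j
  fin_cases i <;> fin_cases j <;> simp [symbol_mul_symbol a b h]

/-- The off-diagonal entry reduces to `i(i - 1){-1}`, which vanishes because `i(i - 1)` is even and
`2{-1} = 0`. The diagonal entries use `{a}{a} = {-1}{a}`. -/
theorem residueMatrix_mul_neg (a : Fˣ) (i : ℤ) :
    residueMatrix F (Additive.ofMul a, i) * residueMatrix F (Additive.ofMul (-a), i) = 0 := by
  obtain ⟨m, hm⟩ : ∃ m, i * (i - 1) = m + m := by
    obtain ⟨m, hm⟩ := Int.even_mul_pred_self i
    exact ⟨m, hm⟩
  set s := symbol F (Additive.ofMul a) with hs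
  set e := symbol F (Additive.ofMul (-1)) with he
  have hee : e + e = 0 := two_symbol_neg_one
  have hss : s * s = e * s := symbol_mul_self _
  have hse : s * e = e * s := by
    have h := symbol_anticomm (Additive.ofMul a) (Additive.ofMul (-1))
    rw [← hs, ← he] at h
    rw [h, neg_eq_iff_add_eq_zero, ← add_mul, hee, zero_mul]
  have hme : (i * (i - 1)) • e = 0 := by
    rw [hm, add_smul, ← smul_add, hee, smul_zero]
  have hme' : i • i • e = i • e := by
    rw [mul_sub, mul_one, sub_smul, mul_smul, sub_eq_zero] at hme
    exact hme
  have hse0 : e * s + e * s = 0 := by rw [← add_mul, hee, zero_mul]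
  simp only [residueMatrix_apply, Matrix.mul_fin_two]
  rw [symbol_neg a, ← hs, ← he]
  ext k l
  fin_cases k <;> fin_cases l
  · simp [mul_add, hss, hse, hse0]
  · simp only [Fin.zero_eta, Fin.mk_one, Matrix.of_apply, Matrix.cons_val', Matrix.cons_val_one,
      Matrix.cons_val_zero, Matrix.cons_val_fin_one, Matrix.zero_apply]
    rw [← (Int.cast_commute i s).eq, ← zsmul_eq_mul, ← zsmul_eq_mul, ← smul_add]
    have : s + (i • e - (e + s)) = i • e - e := by abel
    rw [this, smul_sub, hme', sub_self]
  · simp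
  · simp only [Fin.mk_one, Matrix.of_apply, Matrix.cons_val', Matrix.cons_val_one,
      Matrix.cons_val_fin_one, Matrix.zero_apply, zero_mul, zero_add]
    have h1 : (i • e - s) * (i • e - (e + s)) =
        (i • i • e - i • e) * e - (i • (e * s)) - i • (s * e) + s * e + s * s := by
      simp only [mul_sub, sub_mul, mul_add, smul_mul_assoc, mul_smul_comm, smul_sub]
      abel
    rw [h1, hme', sub_self, zero_mul, hse, hss, zero_sub, ← neg_add', ← smul_add, hse0, smul_zero,
      neg_zero, zero_add, hse0]

/-- The leading coefficient and the order of a Laurent series. -/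
noncomputable def leadingTerm (F : Type*) [Field F] :
    Additive (LaurentSeries F)ˣ →+ Additive Fˣ × ℤ :=
  AddMonoidHom.mk' (fun x => (Additive.ofMul (Units.mk0 (HahnSeries.leadingCoeff (x.toMul : LaurentSeries F))
      (HahnSeries.leadingCoeff_ne_zero.mpr x.toMul.ne_zero)),
      HahnSeries.order (x.toMul : LaurentSeries F))) fun x y => by
    refine Prod.ext (Additive.toMul.injective (Units.ext ?_)) ?_
    · exact HahnSeries.leadingCoeff_mul _ _
    · exact HahnSeries.order_mul x.toMul.ne_zero y.toMul.ne_zero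

theorem leadingTerm_apply (x : (LaurentSeries F)ˣ) : leadingTerm F (Additive.ofMul x) =
    (Additive.ofMul (Units.mk0 (HahnSeries.leadingCoeff (x : LaurentSeries F))
      (HahnSeries.leadingCoeff_ne_zero.mpr x.ne_zero)), HahnSeries.order (x : LaurentSeries F)) := rfl

theorem leadingTerm_eq {x : (LaurentSeries F)ˣ} {n : ℤ} {c : Fˣ}
    (hn : ∀ m < n, (x : LaurentSeries F).coeff m = 0) (hc : (x : LaurentSeries F).coeff n = c) :
    leadingTerm F (Additive.ofMul x) = (Additive.ofMul c, n) := by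
  have h : HahnSeries.order (x : LaurentSeries F) = n := by
    refine le_antisymm (HahnSeries.order_le_of_coeff_ne_zero (hc ▸ c.ne_zero)) ?_
    by_contra! hlt
    exact HahnSeries.leadingCoeff_ne_zero.mpr x.ne_zero (HahnSeries.leadingCoeff_eq.trans (hn _ hlt))
  rw [leadingTerm_apply]
  refine Prod.ext (congrArg Additive.ofMul (Units.ext ?_)) h
  rw [Units.val_mk0, HahnSeries.leadingCoeff_eq, h, hc]

theorem coeff_eq_zero_of_lt_leadingTerm (x : (LaurentSeries F)ˣ) {m : ℤ}
    (hm : m < (leadingTerm F (Additive.ofMul x)).2) : (x : LaurentSeries F).coeff m = 0 :=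
  HahnSeries.coeff_eq_zero_of_lt_order hm

theorem coeff_leadingTerm (x : (LaurentSeries F)ˣ) :
    (x : LaurentSeries F).coeff (leadingTerm F (Additive.ofMul x)).2 =
      (leadingTerm F (Additive.ofMul x)).1.toMul := by
  rw [leadingTerm_apply]
  exact HahnSeries.leadingCoeff_eq.symm

/-- If one series has positive order, the other has leading term `1`. Otherwise the orders agree,
and the leading coefficients add up to `1` in order zero and to `0` in negative order. In each case
the product of the residue matrices vanishes. -/
theorem leadingTerm_cases (a b : (LaurentSeries F)ˣ) (h : (a : LaurentSeries F) + b = 1) :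
    leadingTerm F (Additive.ofMul a) = 0 ∨ leadingTerm F (Additive.ofMul b) = 0 ∨
    (∃ u v : Fˣ, (u : F) + v = 1 ∧ leadingTerm F (Additive.ofMul a) = (Additive.ofMul u, 0) ∧
      leadingTerm F (Additive.ofMul b) = (Additive.ofMul v, 0)) ∨
    ∃ (u : Fˣ) (i : ℤ), leadingTerm F (Additive.ofMul a) = (Additive.ofMul u, i) ∧
      leadingTerm F (Additive.ofMul b) = (Additive.ofMul (-u), i) := by
  have hc : ∀ n, (a : LaurentSeries F).coeff n + (b : LaurentSeries F).coeff n =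
      if n = 0 then 1 else 0 := fun n => by
    rw [← HahnSeries.coeff_add, h, HahnSeries.coeff_one]
    congr
  have ha0 := fun m => coeff_eq_zero_of_lt_leadingTerm a (m := m)
  have hb0 := fun m => coeff_eq_zero_of_lt_leadingTerm b (m := m)
  have ha := coeff_leadingTerm a
  have hb := coeff_leadingTerm b
  generalize hp : leadingTerm F (Additive.ofMul a) = p at *
  generalize hq : leadingTerm F (Additive.ofMul b) = q at *
  obtain ⟨u, i⟩ := p
  obtain ⟨v, j⟩ := q
  dsimp only at *
  rcases lt_or_ge 0 i with hi | hi
  · right; left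
    rw [← hq]
    refine leadingTerm_eq (c := 1) (n := 0) (fun m hm => ?_) ?_
    · have := hc m
      rwa [ha0 m (hm.trans hi), zero_add, if_neg hm.ne] at this
    · have := hc 0
      rwa [ha0 0 hi, zero_add, if_pos rfl] at this
  rcases lt_or_ge 0 j with hj | hj
  · left
    rw [← hp]
    refine leadingTerm_eq (c := 1) (n := 0) (fun m hm => ?_) ?_
    · have := hc m
      rwa [hb0 m (hm.trans hj), add_zero, if_neg hm.ne] at this
    · have := hc 0
      rwa [hb0 0 hj, add_zero, if_pos rfl] at this
  right; right
  have hij : ¬ i < j := fun hlt => by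
    have := hc i
    rw [hb0 i hlt, ha, if_neg (hlt.trans_le hj).ne, add_zero] at this
    exact u.toMul.ne_zero this
  have hji : ¬ j < i := fun hlt => by
    have := hc j
    rw [ha0 j hlt, hb, if_neg (hlt.trans_le hi).ne, zero_add] at this
    exact v.toMul.ne_zero this
  obtain rfl : i = j := le_antisymm (not_lt.mp hji) (not_lt.mp hij)
  have := hc i
  rw [ha, hb] at this
  by_cases hi0 : i = 0
  · subst hi0
    exact Or.inl ⟨u.toMul, v.toMul, by simpa using this, rfl, rfl⟩
  · refine Or.inr ⟨u.toMul, i, rfl, ?_⟩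
    rw [if_neg hi0] at this
    refine Prod.ext (Additive.toMul.injective (Units.ext ?_)) rfl
    simpa using (eq_neg_of_add_eq_zero_right this)

/-- The specialization and the residue for `F⸨T⸩`, as the first row of a matrix. -/
noncomputable def residue (F : Type*) [Field F] :
    MilnorK (LaurentSeries F) →+* Matrix (Fin 2) (Fin 2) (MilnorK F) :=
  lift ((residueMatrix F).comp (leadingTerm F)) fun a b h => by
    simp only [AddMonoidHom.comp_apply]
    rcases leadingTerm_cases a b h with ha | hb | ⟨u, v, huv, ha, hb⟩ | ⟨u, i, ha, hb⟩
    · rw [ha, map_zero, zero_mul]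
    · rw [hb, map_zero, mul_zero]
    · rw [ha, hb, residueMatrix_mul_of_add_eq_one u v huv]
    · rw [ha, hb, residueMatrix_mul_neg]

theorem residue_symbol (x : Additive (LaurentSeries F)ˣ) :
    residue F (symbol _ x) = residueMatrix F (leadingTerm F x) := lift_symbol _ _ x

/-- Constants have order zero, so their matrices are diagonal; the sign comes from moving them past
`ξ`. Consequently entry `(0, 0)` retracts onto `K^M_*(F)`, while entry `(0, 1)` kills constants and
is left linear over them. -/
theorem residue_map (x : MilnorK F) :
    residue F (map HahnSeries.C x) = Matrix.diagonal ![x, signInvolution F x] := by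
  let d : MilnorK F →+* Matrix (Fin 2) (Fin 2) (MilnorK F) :=
    (Matrix.diagonalRingHom (Fin 2) (MilnorK F)).comp
      (RingHom.pi ![RingHom.id _, signInvolution F])
  have hd : ∀ x, d x = Matrix.diagonal ![x, signInvolution F x] := fun x => by
    ext i j
    fin_cases i <;> fin_cases j <;> rfl
  have h : (residue F).comp (map HahnSeries.C) = d := hom_ext fun x => by
    rw [hd, RingHom.comp_apply, show symbol F x = symbol F (Additive.ofMul x.toMul) from rfl,
      map_symbol, residue_symbol, leadingTerm_eq (n := 0) (c := x.toMul), residueMatrix_apply,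
      signInvolution_symbol]
    · ext i j
      fin_cases i <;> fin_cases j <;> simp
    · intro m hm
      exact HahnSeries.coeff_single_of_ne hm.ne
    · exact HahnSeries.coeff_single_same _ _
  rw [← hd, ← h, RingHom.comp_apply]

theorem residue_map_apply_zero_zero (x : MilnorK F) : residue F (map HahnSeries.C x) 0 0 = x := by
  simp [residue_map]

theorem residue_map_apply_zero_one (x : MilnorK F) : residue F (map HahnSeries.C x) 0 1 = 0 := by
  simp [residue_map]

theorem residue_map_mul_apply_zero_one (x : MilnorK F) (y : MilnorK (LaurentSeries F)) :
    residue F (map HahnSeries.C x * y) 0 1 = x * residue F y 0 1 := by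
  simp [residue_map]

/-- The expansion of rational functions at a point. -/
theorem exists_laurentExpansion (a : F) : ∃ φ : RatFunc F →+* LaurentSeries F,
    φ.comp (algebraMap F (RatFunc F)) = HahnSeries.C ∧
    φ RatFunc.X = HahnSeries.single 1 1 + HahnSeries.C a := by
  -- The substitution `X ↦ T + a` is injective on polynomials, so it extends to their fraction
  -- field.
  let f : Polynomial F →+* LaurentSeries F := (HahnSeries.ofPowerSeries ℤ F).comp
    ((Polynomial.coeToPowerSeries.ringHom).comp (Polynomial.taylorAlgHom a).toRingHom)
  have hf : Function.Injective f := HahnSeries.ofPowerSeries_injective.comp fun p q h =>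
    Polynomial.taylor_injective a (Polynomial.coe_injective F h)
  have hfC : ∀ c, f (Polynomial.C c) = HahnSeries.C c := fun c => by
    simp [f]
  have hfX : f Polynomial.X = HahnSeries.single 1 1 + HahnSeries.C a := by
    simp [f, Polynomial.taylor_X]
  refine ⟨IsFractionRing.lift (A := Polynomial F) (K := RatFunc F) hf, ?_, ?_⟩
  · ext1 c
    rw [RingHom.comp_apply, RatFunc.algebraMap_eq_C, ← RatFunc.algebraMap_C, IsFractionRing.lift_algebraMap, hfC]
  · rw [← RatFunc.algebraMap_X, IsFractionRing.lift_algebraMap, hfX]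

end Residue
end MilnorK

namespace MilnorK

/-! ### Split rational functions and products of their symbols -/

section SplitUnits
variable {F : Type u} [Field F]

/-- The group of rational functions `c ∏_{a ∈ A} (t - a) ^ m_a` in an indeterminate `t`, written
additively. -/
abbrev SplitUnits (A : Set F) := Additive Fˣ × (A →₀ ℤ)

section Eval
variable {L : Type*} [Field L] [Algebra F L] (t : L) {A : Set F}
  (hA : ∀ a ∈ A, t - algebraMap F L a ≠ 0)

/-- The value of a rational function `c ∏ (t - a) ^ m_a` at an element of an extension field. -/
noncomputable def splitEval : SplitUnits A →+ Additive Lˣ :=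
  AddMonoidHom.coprod (Units.map (algebraMap F L : F →* L)).toAdditive
    (Finsupp.liftAddHom fun a : A =>
      zmultiplesHom _ (Additive.ofMul (Units.mk0 (t - algebraMap F L a) (hA a a.2))))

theorem splitEval_const (f : Additive Fˣ) : splitEval t hA (f, 0) =
    Additive.ofMul (Units.map (algebraMap F L : F →* L) f.toMul) := by
  rw [splitEval, AddMonoidHom.coprod_apply, map_zero, add_zero]
  rfl

theorem splitEval_single (a : A) : splitEval t hA (0, Finsupp.single a 1) =
    Additive.ofMul (Units.mk0 (t - algebraMap F L a) (hA a a.2)) := by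
  simp [splitEval]

/-- The symbol of the value of a rational function. -/
noncomputable def splitSymbol : SplitUnits A →+ MilnorK L := (symbol L).comp (splitEval t hA)

theorem splitSymbol_const (f : Additive Fˣ) : splitSymbol t hA (f, 0) =
    map (algebraMap F L) (symbol F f) := by
  rw [splitSymbol, AddMonoidHom.comp_apply, splitEval_const]
  exact (map_symbol _ f.toMul).symm

theorem splitSymbol_anticomm (g h : SplitUnits A) :
    splitSymbol t hA g * splitSymbol t hA h = -(splitSymbol t hA h * splitSymbol t hA g) :=
  symbol_anticomm _ _

theorem splitSymbol_single_mul_self (a : A) :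
    splitSymbol t hA (0, Finsupp.single a 1) * splitSymbol t hA (0, Finsupp.single a 1) =
      map (algebraMap F L) (symbol F (Additive.ofMul (-1))) *
        splitSymbol t hA (0, Finsupp.single a 1) := by
  rw [map_symbol, show Units.map (algebraMap F L : F →* L) (-1) = -1 from Units.ext (by simp)]
  exact symbol_mul_self _

/-- Since `(t - a) - (t - b) = c`, the relation for a difference applies, and its term `{c}{-c}`
vanishes. The coefficients `{c}` and `{-c}` do not depend on `t`. -/
theorem splitSymbol_single_mul_single (a b : A) (c : Fˣ) (hc : (b : F) - a = c) :
    splitSymbol t hA (0, Finsupp.single a 1) * splitSymbol t hA (0, Finsupp.single b 1) =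
      map (algebraMap F L) (symbol F (Additive.ofMul c)) *
        splitSymbol t hA (0, Finsupp.single b 1) -
      map (algebraMap F L) (symbol F (Additive.ofMul (-c))) *
        splitSymbol t hA (0, Finsupp.single a 1) := by
  have h := symbol_mul_symbol_of_sub_eq (x := Units.mk0 (t - algebraMap F L a) (hA a a.2))
    (y := Units.mk0 (t - algebraMap F L b) (hA b b.2))
    (c := Units.map (algebraMap F L : F →* L) c) (by simp [← hc])
  have hn : -Units.map (algebraMap F L : F →* L) c = Units.map (algebraMap F L : F →* L) (-c) :=
    Units.ext (by simp)
  simp only [map_symbol, splitSymbol, AddMonoidHom.comp_apply, splitEval_single]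
  rw [sub_mul, mul_sub, mul_sub, symbol_mul_symbol_neg, sub_zero, hn,
    symbol_anticomm _ (Additive.ofMul (Units.map (algebraMap F L : F →* L) (-c)))] at h
  rw [sub_neg_eq_add, sub_eq_zero, ← eq_sub_iff_add_eq] at h
  exact h

end Eval

theorem splitUnits_mem {A : Set F} (V : AddSubgroup (SplitUnits A)) (h0 : ∀ f, (f, 0) ∈ V)
    (h1 : ∀ a, (0, Finsupp.single a 1) ∈ V) (g : SplitUnits A) : g ∈ V := by
  obtain ⟨f, m⟩ := g
  have hm : ((0 : Additive Fˣ), m) ∈ V := by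
    induction m using Finsupp.induction_linear with
    | zero => exact V.zero_mem
    | add m n hm hn => simpa using V.add_mem hm hn
    | single a n => simpa using V.zsmul_mem (h1 a) n
  simpa using V.add_mem (h0 f) hm

/-- The action map `K^M_*(F) ⊗ M → K^M_*(L)` defined by a homomorphism from `M`. -/
noncomputable def extendedAction {L M : Type*} [Field L] [AddCommGroup M] (φ : F →+* L)
    (h : M →+ MilnorK L) : MilnorK F ⊗[ℤ] M →ₗ[ℤ] MilnorK L :=
  TensorProduct.lift ((LinearMap.mul ℤ (MilnorK L)).compl₁₂
    (map φ).toIntAlgHom.toLinearMap h.toIntLinearMap)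

theorem extendedAction_tmul {L M : Type*} [Field L] [AddCommGroup M] (φ : F →+* L)
    (h : M →+ MilnorK L) (x : MilnorK F) (m : M) :
    extendedAction φ h (x ⊗ₜ m) = map φ x * h m := rfl

theorem extendedAction_smul {L M : Type*} [Field L] [AddCommGroup M] (φ : F →+* L)
    (h : M →+ MilnorK L) (x : MilnorK F) (z : MilnorK F ⊗[ℤ] M) :
    extendedAction φ h (x • z) = map φ x * extendedAction φ h z := by
  induction z using TensorProduct.induction_on with
  | zero => simp
  | tmul y m => simp [TensorProduct.smul_tmul', extendedAction_tmul, mul_assoc]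
  | add y z hy hz => rw [smul_add, map_add, hy, hz, map_add, mul_add]

/-- The elements of degree two of `K^M_*(F) ⊗ M`, where `M` is placed in degree one. -/
noncomputable abbrev degreeTwo (F : Type u) [Field F] (M : Type*) [AddCommGroup M] :=
  LinearMap.range (TensorProduct.map (component F 1).subtype (LinearMap.id (R := ℤ) (M := M)))

theorem symbol_tmul_mem_degreeTwo {M : Type*} [AddCommGroup M] (f : Additive Fˣ) (m : M) :
    symbol F f ⊗ₜ m ∈ degreeTwo F M :=
  ⟨(⟨symbol F f, symbol_mem F f⟩ : component F 1) ⊗ₜ m, rfl⟩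

/-- Products of two symbols of split rational functions are sums of products `{f} {g}` with `f`
constant; the formula does not depend on the value of the indeterminate. -/
theorem exists_degreeTwo_eq_mul {L₁ L₂ : Type*} [Field L₁] [Field L₂] [Algebra F L₁]
    [Algebra F L₂] {A : Set F} {t₁ : L₁} {t₂ : L₂} (h₁ : ∀ a ∈ A, t₁ - algebraMap F L₁ a ≠ 0)
    (h₂ : ∀ a ∈ A, t₂ - algebraMap F L₂ a ≠ 0) (g h : SplitUnits A) :
    ∃ s ∈ degreeTwo F (SplitUnits A),
      extendedAction (algebraMap F L₁) (splitSymbol t₁ h₁) s =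
        splitSymbol t₁ h₁ g * splitSymbol t₁ h₁ h ∧
      extendedAction (algebraMap F L₂) (splitSymbol t₂ h₂) s =
        splitSymbol t₂ h₂ g * splitSymbol t₂ h₂ h := by
  -- Working in the product of the two rings forces a single `s` to serve both evaluations.
  let Q : Submodule ℤ (MilnorK L₁ × MilnorK L₂) := (degreeTwo F (SplitUnits A)).map
    (LinearMap.prod (extendedAction (algebraMap F L₁) (splitSymbol t₁ h₁))
      (extendedAction (algebraMap F L₂) (splitSymbol t₂ h₂)))
  let σ : SplitUnits A →+ MilnorK L₁ × MilnorK L₂ := (splitSymbol t₁ h₁).prod (splitSymbol t₂ h₂)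
  have hQ : ∀ f g, (map (algebraMap F L₁) (symbol F f) * splitSymbol t₁ h₁ g,
      map (algebraMap F L₂) (symbol F f) * splitSymbol t₂ h₂ g) ∈ Q := fun f g =>
    ⟨_, symbol_tmul_mem_degreeTwo f g, rfl⟩
  have hanti : ∀ g h, σ g * σ h = -(σ h * σ g) := fun g h =>
    Prod.ext (splitSymbol_anticomm _ _ _ _) (splitSymbol_anticomm _ _ _ _)
  have hconst : ∀ f g, σ (f, 0) * σ g ∈ Q := fun f g => by
    have := hQ f g
    rw [← splitSymbol_const t₁ h₁, ← splitSymbol_const t₂ h₂] at this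
    exact this
  have main : ∀ g h, σ g * σ h ∈ Q := by
    intro g h
    refine splitUnits_mem (Q.toAddSubgroup.comap ((AddMonoidHom.mulRight (σ h)).comp σ))
      (fun f => hconst f h) (fun a => ?_) g
    refine splitUnits_mem (Q.toAddSubgroup.comap
      ((AddMonoidHom.mulLeft (σ (0, Finsupp.single a 1))).comp σ)) (fun f => ?_) (fun b => ?_) h
    · change σ _ * σ _ ∈ Q
      rw [hanti]
      exact Q.neg_mem (hconst _ _)
    · change σ _ * σ _ ∈ Q
      by_cases hab : a = b
      · subst hab
        have h := hQ (Additive.ofMul (-1)) (0, Finsupp.single a 1)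
        rw [← splitSymbol_single_mul_self, ← splitSymbol_single_mul_self] at h
        exact h
      · have hne : (b : F) - a ≠ 0 := sub_ne_zero.mpr fun h => hab (Subtype.ext h.symm)
        let c : Fˣ := Units.mk0 _ hne
        have h := Q.sub_mem (hQ (Additive.ofMul c) (0, Finsupp.single b 1))
          (hQ (Additive.ofMul (-c)) (0, Finsupp.single a 1))
        rw [Prod.mk_sub_mk, ← splitSymbol_single_mul_single t₁ h₁ a b c rfl,
          ← splitSymbol_single_mul_single t₂ h₂ a b c rfl] at h
        exact h
  obtain ⟨s, hs, hsQ⟩ := main g h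
  exact ⟨s, hs, congrArg Prod.fst hsQ, congrArg Prod.snd hsQ⟩

/-- A split polynomial with no root outside `A` defines a split rational function. -/
theorem exists_splitEval_eq_aeval {L₁ L₂ : Type*} [Field L₁] [Field L₂] [Algebra F L₁]
    [Algebra F L₂] {A : Set F} {t₁ : L₁} {t₂ : L₂} (h₁ : ∀ a ∈ A, t₁ - algebraMap F L₁ a ≠ 0)
    (h₂ : ∀ a ∈ A, t₂ - algebraMap F L₂ a ≠ 0) {p : Polynomial F} (hp : p.Splits) (hp0 : p ≠ 0)
    (hpA : ∀ a, p.IsRoot a → a ∈ A) :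
    ∃ g : SplitUnits A, ((splitEval t₁ h₁ g).toMul : L₁) = Polynomial.aeval t₁ p ∧
      ((splitEval t₂ h₂ g).toMul : L₂) = Polynomial.aeval t₂ p := by
  induction hp using Submonoid.closure_induction with
  | mem p hp =>
    rcases hp with ⟨a, rfl⟩ | ⟨a, rfl⟩
    · have ha : a ≠ 0 := fun h => hp0 (by rw [h, Polynomial.C_0])
      refine ⟨(Additive.ofMul (Units.mk0 a ha), 0), ?_, ?_⟩ <;> simp [splitEval_const]
    · have ha : -a ∈ A := hpA _ (by simp)
      refine ⟨(0, Finsupp.single ⟨-a, ha⟩ 1), ?_, ?_⟩ <;> simp [splitEval_single]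
  | one => exact ⟨0, by simp, by simp⟩
  | mul p q _ _ hp hq =>
    obtain ⟨g, hg₁, hg₂⟩ := hp (left_ne_zero_of_mul hp0)
      fun a ha => hpA a (Polynomial.root_mul_right_of_isRoot _ ha)
    obtain ⟨h, hh₁, hh₂⟩ := hq (right_ne_zero_of_mul hp0)
      fun a ha => hpA a (Polynomial.root_mul_left_of_isRoot _ ha)
    refine ⟨g + h, ?_, ?_⟩ <;> simp [*]

end SplitUnits

/-! ### Polynomials of degree at most `k/2` and fractions in a primitive element -/

section PrimitiveElement
open Polynomial
variable {F : Type u} {E : Type v} [Field F] [Field E] [Algebra F E] [FiniteDimensional F E]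

/-- An irreducible factor `g` of `p` defines the extension `AdjoinRoot g` of degree at most `k/2`,
so `g` is linear. -/
theorem splits_of_natDegree_le {k : ℕ}
    (hF : ∀ (L : Type u) [Field L] [Algebra F L] [FiniteDimensional F L],
      (Module.finrank F L : ℝ) ≤ (k : ℝ) / 2 → Module.finrank F L = 1)
    {p : F[X]} (hp : p.natDegree ≤ k / 2) : p.Splits := by
  by_cases hp0 : p = 0
  · exact hp0 ▸ Splits.zero
  obtain ⟨u, hu⟩ := UniqueFactorizationMonoid.factors_prod hp0
  rw [← hu]
  refine (Splits.multisetProd fun g hgp => ?_).mul u.isUnit.splits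
  have hg := UniqueFactorizationMonoid.irreducible_of_factor g hgp
  replace hgp := UniqueFactorizationMonoid.dvd_of_mem_factors hgp
  have : Fact (Irreducible g) := ⟨hg⟩
  have hfin : Module.finrank F (AdjoinRoot g) = g.natDegree := by
    rw [(AdjoinRoot.powerBasis hg.ne_zero).finrank, AdjoinRoot.powerBasis_dim]
  have : FiniteDimensional F (AdjoinRoot g) := (AdjoinRoot.powerBasis hg.ne_zero).finite
  have h := hF (AdjoinRoot g) (by
    rw [hfin, le_div_iff₀ two_pos]
    have := (natDegree_le_of_dvd hgp hp0).trans hp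
    exact_mod_cast (by omega : g.natDegree * 2 ≤ k))
  rw [hfin] at h
  exact Splits.of_natDegree_eq_one h

theorem aeval_ne_zero_of_natDegree_lt {θ : E} (hθ : IntermediateField.adjoin F {θ} = ⊤)
    {p : F[X]} (hp0 : p ≠ 0) (hp : p.natDegree < Module.finrank F E) : aeval θ p ≠ 0 := fun h => by
  have hd := natDegree_le_natDegree (minpoly.degree_le_of_ne_zero F θ hp0 h)
  rw [(Field.primitive_element_iff_minpoly_natDegree_eq F θ).mp hθ] at hd
  exact absurd hp hd.not_gt

/-- Every element of `E = F(θ)` is a fraction of polynomials in `θ` of degree at most `[E : F]/2`. -/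
theorem exists_fraction {θ : E} (hθ : IntermediateField.adjoin F {θ} = ⊤) {e : E} (he : e ≠ 0) :
    ∃ p q : F[X], p ≠ 0 ∧ q ≠ 0 ∧ p.natDegree ≤ Module.finrank F E / 2 ∧
      q.natDegree ≤ Module.finrank F E / 2 ∧ aeval θ p = e * aeval θ q := by
  set k := Module.finrank F E with hk
  have hkpos : 0 < k := Module.finrank_pos
  have hlt : ∀ p : F[X], p.natDegree ≤ k / 2 → p.natDegree < k := fun p hp => by omega
  let P := degreeLT F (k / 2 + 1)
  have : FiniteDimensional F P := (degreeLTEquiv F (k / 2 + 1)).symm.finiteDimensional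
  have hP : Module.finrank F P = k / 2 + 1 := by
    rw [(degreeLTEquiv F (k / 2 + 1)).finrank_eq, Module.finrank_fin_fun]
  -- The map `(p, q) ↦ p(θ) - e q(θ)` has a kernel, since its source has dimension `2(⌊k/2⌋ + 1) >
  -- k`.
  let f : P × P →ₗ[F] E := LinearMap.coprod ((aeval θ).toLinearMap ∘ₗ P.subtype)
    (-(LinearMap.mulLeft F e ∘ₗ (aeval θ).toLinearMap ∘ₗ P.subtype))
  have hker : LinearMap.ker f ≠ ⊥ := LinearMap.ker_ne_bot_of_finrank_lt (by
    rw [Module.finrank_prod, hP, ← hk]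
    omega)
  obtain ⟨⟨p, q⟩, hpq, hne⟩ := Submodule.exists_mem_ne_zero_of_ne_bot hker
  have hdeg : ∀ p : P, (p : F[X]).natDegree ≤ k / 2 := fun p => by
    have := mem_degreeLT.mp p.2
    by_cases hp0 : (p : F[X]) = 0
    · simp [hp0]
    · rw [degree_eq_natDegree hp0] at this
      have : (p : F[X]).natDegree < k / 2 + 1 := by exact_mod_cast this
      omega
  have heq : aeval θ (p : F[X]) = e * aeval θ (q : F[X]) := by
    have : aeval θ (p : F[X]) + -(e * aeval θ (q : F[X])) = 0 := hpq
    rwa [← sub_eq_add_neg, sub_eq_zero] at this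
  have hzero : ∀ p : P, aeval θ (p : F[X]) = 0 → p = 0 := fun p hp => by
    by_contra hp0
    exact aeval_ne_zero_of_natDegree_lt hθ (fun h => hp0 (Subtype.ext h))
      (hlt _ (hdeg p)) hp
  refine ⟨p, q, fun hp0 => hne ?_, fun hq0 => hne ?_, hdeg p, hdeg q, heq⟩
  · rw [hp0, map_zero, zero_eq_mul] at heq
    exact Prod.ext (Subtype.ext hp0) (hzero q (heq.resolve_left he))
  · rw [hq0, map_zero, mul_zero] at heq
    exact Prod.ext (hzero p heq) (Subtype.ext hq0)

end PrimitiveElement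

end MilnorK

namespace MilnorK

/-! ### Independence of the symbols of linear polynomials -/

section Independence
variable {F : Type u} [Field F]

/-- Expansion at `0` followed by specialization is a left inverse. -/
theorem map_ratFunc_injective : Function.Injective (map (algebraMap F (RatFunc F))) := by
  obtain ⟨φ, hφ, -⟩ := exists_laurentExpansion (0 : F)
  refine Function.LeftInverse.injective (g := fun y => residue F (map φ y) 0 0) fun x => ?_
  dsimp only
  rw [map_map, hφ, residue_map_apply_zero_zero]

/-- This is the residue at `X = a`, entry `(0, 1)` after expansion there: `X - b` becomes `T + (a -
b)`, of order one if `b = a` and zero otherwise. -/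
theorem exists_residue (a : F) : ∃ d : MilnorK (RatFunc F) →+ MilnorK F,
    (∀ x, d (map (algebraMap F (RatFunc F)) x) = 0) ∧
    (∀ x y, d (map (algebraMap F (RatFunc F)) x * y) = x * d y) ∧
    ∀ (b : F) (u : (RatFunc F)ˣ), (u : RatFunc F) = RatFunc.X - algebraMap F (RatFunc F) b →
      (b = a → d (symbol _ (Additive.ofMul u)) = 1) ∧
        (b ≠ a → d (symbol _ (Additive.ofMul u)) = 0) := by
  obtain ⟨φ, hφ, hX⟩ := exists_laurentExpansion a
  refine ⟨AddMonoidHom.mk' (fun y => residue F (map φ y) 0 1)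
    (fun x y => by rw [map_add, map_add]; rfl), fun x => ?_, fun x y => ?_, fun b u hu => ?_⟩
  · change residue F (map φ _) 0 1 = 0
    rw [map_map, hφ, residue_map_apply_zero_one]
  · change residue F (map φ _) 0 1 = _
    rw [map_mul, map_map, hφ, residue_map_mul_apply_zero_one]
    rfl
  · change (_ → residue F (map φ _) 0 1 = _) ∧ (_ → residue F (map φ _) 0 1 = _)
    rw [map_symbol, residue_symbol]
    have hval : ((Units.map (φ : RatFunc F →* LaurentSeries F) u : (LaurentSeries F)ˣ) :
        LaurentSeries F) = HahnSeries.single 1 1 + HahnSeries.C (a - b) := by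
      rw [Units.coe_map, hu]
      change φ _ = _
      have hb : φ (algebraMap F (RatFunc F) b) = HahnSeries.C b := by
        rw [← hφ, RingHom.comp_apply]
      rw [map_sub, hX, hb, map_sub]
      abel
    have hcoeff : ∀ m : ℤ, ((Units.map (φ : RatFunc F →* LaurentSeries F) u :
        (LaurentSeries F)ˣ) : LaurentSeries F).coeff m =
        (if m = 1 then 1 else 0) + if m = 0 then a - b else 0 := fun m => by
      rw [hval, HahnSeries.coeff_add, HahnSeries.coeff_single, HahnSeries.C_apply,
        HahnSeries.coeff_single]
      congr
    refine ⟨fun hba => ?_, fun hba => ?_⟩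
    · subst hba
      rw [leadingTerm_eq (n := 1) (c := 1), residueMatrix_apply]
      · simp
      · intro m hm
        rw [hcoeff, if_neg hm.ne, sub_self, ite_self, add_zero]
      · rw [hcoeff]
        simp
    · rw [leadingTerm_eq (n := 0) (c := Units.mk0 (a - b) (sub_ne_zero.mpr (Ne.symm hba))),
        residueMatrix_apply]
      · simp
      · intro m hm
        rw [hcoeff, if_neg hm.ne, if_neg (by omega), add_zero]
      · rw [hcoeff]
        simp

theorem ratFunc_X_sub_ne_zero {A : Set F} : ∀ a ∈ A,
    (RatFunc.X : RatFunc F) - algebraMap F (RatFunc F) a ≠ 0 := fun a _ h => by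
  refine RatFunc.transcendental_X (K := F) ⟨Polynomial.X - Polynomial.C a,
    Polynomial.X_sub_C_ne_zero a, ?_⟩
  simpa using h

theorem exists_eq_const_add_sum {A : Set F} (z : MilnorK F ⊗[ℤ] SplitUnits A) :
    ∃ (w : MilnorK F ⊗[ℤ] Additive Fˣ) (c : A →₀ MilnorK F),
      z = LinearMap.lTensor (MilnorK F) (AddMonoidHom.inl (Additive Fˣ) (A →₀ ℤ)).toIntLinearMap w +
        c.sum fun a x => x ⊗ₜ ((0, Finsupp.single a 1) : SplitUnits A) := by
  have hadd : ∀ c c' : A →₀ MilnorK F,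
      ((c + c').sum fun a x => x ⊗ₜ[ℤ] ((0, Finsupp.single a 1) : SplitUnits A)) =
        (c.sum fun a x => x ⊗ₜ[ℤ] ((0, Finsupp.single a 1) : SplitUnits A)) +
          c'.sum fun a x => x ⊗ₜ[ℤ] ((0, Finsupp.single a 1) : SplitUnits A) := fun c c' =>
    Finsupp.sum_add_index' (fun _ => TensorProduct.zero_tmul _ _)
      (fun _ _ _ => TensorProduct.add_tmul _ _ _)
  induction z using TensorProduct.induction_on with
  | zero => exact ⟨0, 0, by simp⟩
  | add y z hy hz =>
    obtain ⟨w, c, rfl⟩ := hy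
    obtain ⟨w', c', rfl⟩ := hz
    exact ⟨w + w', c + c', by rw [map_add, hadd]; abel⟩
  | tmul x g =>
    obtain ⟨f, m⟩ := g
    suffices h : ∃ c : A →₀ MilnorK F, x ⊗ₜ[ℤ] ((0, m) : SplitUnits A) =
        c.sum fun a x => x ⊗ₜ ((0, Finsupp.single a 1) : SplitUnits A) by
      obtain ⟨c, hc⟩ := h
      refine ⟨x ⊗ₜ f, c, ?_⟩
      rw [← hc, LinearMap.lTensor_tmul]
      change _ = x ⊗ₜ[ℤ] ((f, 0) : SplitUnits A) + _
      rw [← TensorProduct.tmul_add, Prod.mk_add_mk, add_zero, zero_add]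
    induction m using Finsupp.induction_linear with
    | zero => exact ⟨0, by rw [Finsupp.sum_zero_index]; exact TensorProduct.tmul_zero _ _⟩
    | add m n hm hn =>
      obtain ⟨c, hc⟩ := hm
      obtain ⟨c', hc'⟩ := hn
      refine ⟨c + c', ?_⟩
      rw [hadd, ← hc, ← hc', ← TensorProduct.tmul_add, Prod.mk_add_mk, add_zero]
    | single a n =>
      refine ⟨Finsupp.single a (n • x), ?_⟩
      rw [Finsupp.sum_single_index (h := fun a x => x ⊗ₜ[ℤ]
          ((0, Finsupp.single a 1) : SplitUnits A)) (TensorProduct.zero_tmul _ _),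
        TensorProduct.smul_tmul,
        Prod.smul_mk, smul_zero, Finsupp.smul_single, smul_eq_mul, mul_one]

/-- The symbols `{X - a}` are linearly independent over `K^M_*(F)` in `K^M_*(F(X))`. -/
theorem exists_const_of_extendedAction_ratFunc_eq_zero {A : Set F}
    (z : MilnorK F ⊗[ℤ] SplitUnits A)
    (hz : extendedAction (algebraMap F (RatFunc F))
      (splitSymbol RatFunc.X ratFunc_X_sub_ne_zero) z = 0) :
    ∃ w : MilnorK F ⊗[ℤ] Additive Fˣ,
      z = LinearMap.lTensor (MilnorK F) (AddMonoidHom.inl (Additive Fˣ) (A →₀ ℤ)).toIntLinearMap w ∧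
      extendedAction (RingHom.id F) (symbol F) w = 0 := by
  obtain ⟨w, c, rfl⟩ := exists_eq_const_add_sum z
  have hw : ∀ w : MilnorK F ⊗[ℤ] Additive Fˣ, extendedAction (algebraMap F (RatFunc F))
      (splitSymbol RatFunc.X (ratFunc_X_sub_ne_zero (A := A)))
      (LinearMap.lTensor (MilnorK F) (AddMonoidHom.inl (Additive Fˣ) (A →₀ ℤ)).toIntLinearMap w) =
      map (algebraMap F (RatFunc F)) (extendedAction (RingHom.id F) (symbol F) w) := fun w => by
    induction w using TensorProduct.induction_on with
    | zero => simp
    | add y z hy hz => simp only [map_add, hy, hz]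
    | tmul x f =>
      rw [LinearMap.lTensor_tmul, extendedAction_tmul, extendedAction_tmul, map_mul, map_map,
        RingHom.comp_id]
      congr 1
      exact splitSymbol_const _ _ f
  -- The residue at `a` kills the constant part and every summand except the one at `a`, leaving `c
  -- a`.
  have hc : c = 0 := by
    ext a
    obtain ⟨d, hd0, hdmul, hdX⟩ := exists_residue (a : F)
    have h := congrArg d hz
    rw [map_add, map_add, hw, hd0, zero_add, map_zero, Finsupp.sum, map_sum, map_sum] at h
    have hterm : ∀ b, d (extendedAction (algebraMap F (RatFunc F))
        (splitSymbol RatFunc.X ratFunc_X_sub_ne_zero) (c b ⊗ₜ (0, Finsupp.single b 1))) =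
        c b * d (symbol _ (splitEval RatFunc.X ratFunc_X_sub_ne_zero
          ((0, Finsupp.single b 1) : SplitUnits A))) := fun b => by
      rw [extendedAction_tmul, hdmul]
      rfl
    rw [Finset.sum_eq_single a] at h
    · rwa [hterm, splitEval_single, (hdX a _ rfl).1 rfl, mul_one] at h
    · intro b _ hba
      rw [hterm, splitEval_single, (hdX b _ rfl).2 fun hab => hba (Subtype.ext hab), mul_zero]
    · intro ha
      rw [hterm, Finsupp.notMem_support_iff.mp ha, zero_mul]
  subst hc
  rw [Finsupp.sum_zero_index, add_zero] at hz ⊢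
  rw [hw] at hz
  exact ⟨w, rfl, map_ratFunc_injective (hz.trans (map_zero _).symm)⟩

end Independence
end MilnorK

namespace MilnorK

/-! ### The ring generated by symbols of split functions, and its ideals -/

section SplitRing
variable {F : Type u} [Field F]

section Span
variable {L : Type*} [Field L] [Algebra F L] {A : Set F} {t : L}
  (h : ∀ a ∈ A, t - algebraMap F L a ≠ 0)

/-- The subring of `K^M_*(L)` generated by the constants and the symbols `{t - a}` is generated by
symbols as a module over `K^M_*(F)`, up to integers. -/
theorem exists_eq_int_add_of_mem_closure {y : MilnorK L}
    (hy : y ∈ Subring.closure (Set.range (splitSymbol t h))) :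
    ∃ (n : ℤ) (z : MilnorK F ⊗[ℤ] SplitUnits A),
      y = n + extendedAction (algebraMap F L) (splitSymbol t h) z := by
  let T := extendedAction (algebraMap F L) (splitSymbol t h)
  let V : AddSubgroup (MilnorK L) := (Int.castAddHom (MilnorK L)).range ⊔ T.toAddMonoidHom.range
  have hT : ∀ z, T z ∈ V := fun z => (le_sup_right : _ ≤ V) ⟨z, rfl⟩
  have hV : y ∈ V := by
    refine mem_of_mem_subringClosure V ((le_sup_left : _ ≤ V) ⟨1, by simp⟩) ?_ hy
    rintro v hv _ ⟨g, rfl⟩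
    obtain ⟨_, ⟨n, rfl⟩, _, ⟨z, rfl⟩, rfl⟩ := AddSubgroup.mem_sup.mp hv
    rw [add_mul]
    refine V.add_mem ?_ ?_
    · have : (Int.castAddHom (MilnorK L) n) * splitSymbol t h g = T ((n : MilnorK F) ⊗ₜ g) := by
        simp [T, extendedAction_tmul]
      rw [this]
      exact hT _
    · clear hv
      change T z * _ ∈ V
      induction z using TensorProduct.induction_on with
      | zero => simp
      | add y z hy hz =>
        rw [map_add, add_mul]
        exact V.add_mem hy hz
      | tmul x g' =>
        -- The product `{g'}{g}` is replaced by a combination of terms `{f}{g''}` with `f` constant,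
        -- so one nonconstant symbol remains.
        obtain ⟨s, -, hs, -⟩ := exists_degreeTwo_eq_mul h h g' g
        have : T (x ⊗ₜ g') * splitSymbol t h g = T (x • s) := by
          simp only [T, extendedAction_tmul, extendedAction_smul, hs, mul_assoc]
        rw [this]
        exact hT _
  obtain ⟨_, ⟨n, rfl⟩, _, ⟨z, rfl⟩, rfl⟩ := AddSubgroup.mem_sup.mp hV
  exact ⟨n, z, rfl⟩

end Span

/-- The subring of `K^M_*(F(X))` generated by the symbols of split rational functions. -/
noncomputable abbrev splitRing (A : Set F) : Subring (MilnorK (RatFunc F)) :=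
  Subring.closure (Set.range (splitSymbol (A := A) RatFunc.X ratFunc_X_sub_ne_zero))

/-- The symbol of a split rational function, in the ring generated by these symbols. -/
noncomputable def splitRingSymbol (A : Set F) : SplitUnits A →+ splitRing A :=
  AddMonoidHom.codRestrict (splitSymbol RatFunc.X ratFunc_X_sub_ne_zero) (splitRing A)
    fun g => Subring.subset_closure ⟨g, rfl⟩

theorem coe_splitRingSymbol {A : Set F} (g : SplitUnits A) :
    (splitRingSymbol A g : MilnorK (RatFunc F)) =
      splitSymbol RatFunc.X ratFunc_X_sub_ne_zero g := rfl

theorem splitRingSymbol_anticomm {A : Set F} (g h : SplitUnits A) :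
    splitRingSymbol A g * splitRingSymbol A h = -(splitRingSymbol A h * splitRingSymbol A g) :=
  Subtype.ext (splitSymbol_anticomm _ _ g h)

/-- The homomorphism from `K^M_*(F)` to the ring generated by symbols of split rational functions. -/
noncomputable def constHom (A : Set F) : MilnorK F →+* splitRing A :=
  lift ((splitRingSymbol A).comp (AddMonoidHom.inl _ _)) fun a b hab => Subtype.ext <| by
    change splitSymbol _ _ (_, 0) * splitSymbol _ _ (_, 0) = 0
    rw [splitSymbol_const, splitSymbol_const, ← map_mul, symbol_mul_symbol a b hab, map_zero]

theorem constHom_symbol {A : Set F} (f : Additive Fˣ) :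
    constHom A (symbol F f) = splitRingSymbol A (f, 0) := lift_symbol _ _ f

theorem coe_constHom {A : Set F} (x : MilnorK F) :
    (constHom A x : MilnorK (RatFunc F)) = map (algebraMap F (RatFunc F)) x := by
  have : (splitRing A).subtype.comp (constHom A) = map (algebraMap F (RatFunc F)) :=
    hom_ext fun f => by
      rw [RingHom.comp_apply, constHom_symbol]
      exact splitSymbol_const _ _ f
  exact DFunLike.congr_fun this x

/-- The ideal generated by the symbols `{n}` for `n` in a subgroup `N`. -/
noncomputable def symbolIdeal {A : Set F} (N : AddSubgroup (SplitUnits A)) : Ideal (splitRing A) :=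
  Ideal.span (splitRingSymbol A '' N)

/-- The ring is generated by symbols, and these anticommute with the generators of the left ideal.
-/
instance symbolIdeal_isTwoSided {A : Set F} (N : AddSubgroup (SplitUnits A)) :
    (symbolIdeal N).IsTwoSided := by
  refine ⟨fun {y} r hy => ?_⟩
  obtain ⟨r, hr⟩ := r
  induction hr using Subring.closure_induction generalizing y with
  | mem r hr =>
    obtain ⟨g, rfl⟩ := hr
    change y * splitRingSymbol A g ∈ _
    induction hy using Submodule.closure_induction with
    | zero => simp
    | add x y _ _ hx hy => rw [add_mul]; exact Ideal.add_mem _ hx hy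
    | smul_mem r x hx =>
      obtain ⟨n, hn, rfl⟩ := hx
      rw [smul_eq_mul, mul_assoc, splitRingSymbol_anticomm, mul_neg, ← mul_assoc]
      exact neg_mem (Ideal.mul_mem_left _ _ (Ideal.subset_span ⟨n, hn, rfl⟩))
  | zero => exact (mul_zero y).symm ▸ Ideal.zero_mem _
  | one => exact (mul_one y).symm ▸ hy
  | add a b ha hb iha ihb =>
    have := Ideal.add_mem _ (iha hy) (ihb hy)
    rwa [← mul_add] at this
  | neg a ha iha =>
    have := neg_mem (iha hy)
    rwa [← mul_neg] at this
  | mul a b ha hb iha ihb =>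
    have := ihb (iha hy)
    rwa [mul_assoc] at this

end SplitRing

/-! ### Relations over `E` lifted to `F(X)` -/

section Main
variable {F : Type u} {E : Type v} [Field F] [Field E] [Algebra F E]

/-- The submodule of `K^M_*(F) ⊗ Eˣ` generated by the relations of degree two in `K^M_*(E)`. -/
noncomputable def quadraticRelations (F : Type u) (E : Type v) [Field F] [Field E] [Algebra F E] :
    Submodule (MilnorK F) (MilnorK F ⊗[ℤ] Additive Eˣ) :=
  Submodule.span (MilnorK F) {z | extendedAction (algebraMap F E) (symbol E) z = 0 ∧
    z ∈ degreeTwo F (Additive Eˣ)}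

/-- Modulo `quadraticRelations` the classes of `1 ⊗ f` satisfy the Steinberg relations, so the class
of `x ⊗ f` depends additively on `x{f}` alone. It follows that `w` has the class of `0`. -/
theorem mk_lTensor_eq_zero (w : MilnorK F ⊗[ℤ] Additive Fˣ)
    (hw : extendedAction (RingHom.id F) (symbol F) w = 0) :
    LinearMap.lTensor (MilnorK F)
      (Units.map (algebraMap F E : F →* E)).toAdditive.toIntLinearMap w ∈ quadraticRelations F E := by
  let i : Additive Fˣ →+ Additive Eˣ := (Units.map (algebraMap F E : F →* E)).toAdditive
  have hi : ∀ a : Fˣ, i (Additive.ofMul a) = Additive.ofMul (Units.map (algebraMap F E : F →* E) a) :=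
    fun _ => rfl
  let h : Additive Fˣ →+ (MilnorK F ⊗[ℤ] Additive Eˣ) ⧸ quadraticRelations F E :=
    (quadraticRelations F E).mkQ.toAddMonoidHom.comp
      ((TensorProduct.mk ℤ (MilnorK F) (Additive Eˣ) 1).toAddMonoidHom.comp i)
  have hh : ∀ x f, x • h f = (quadraticRelations F E).mkQ (x ⊗ₜ i f) := fun x f => by
    change x • (quadraticRelations F E).mkQ (1 ⊗ₜ i f) = _
    rw [← map_smul, TensorProduct.smul_tmul', smul_eq_mul, mul_one]
  obtain ⟨Ψ, hΨ⟩ := exists_addMonoidHom_mul_symbol h fun a b hab => by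
    rw [hh, Submodule.mkQ_apply, Submodule.Quotient.mk_eq_zero]
    refine Submodule.subset_span ⟨?_, symbol_tmul_mem_degreeTwo _ _⟩
    rw [extendedAction_tmul, map_symbol, hi]
    apply symbol_mul_symbol
    simp [← map_add, hab]
  have key : ∀ w, Ψ (extendedAction (RingHom.id F) (symbol F) w) =
      (quadraticRelations F E).mkQ (LinearMap.lTensor (MilnorK F) i.toIntLinearMap w) := fun w => by
    induction w using TensorProduct.induction_on with
    | zero => simp
    | add y z hy hz => simp only [map_add, hy, hz]
    | tmul x f =>
      have hid : map (RingHom.id F) x = x := by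
        have : map (RingHom.id F) = RingHom.id (MilnorK F) := hom_ext fun f => map_symbol _ f.toMul
        rw [this, RingHom.id_apply]
      rw [extendedAction_tmul, hid, hΨ, hh, LinearMap.lTensor_tmul]
      rfl
  have := key w
  rwa [hw, map_zero, eq_comm, Submodule.mkQ_apply, Submodule.Quotient.mk_eq_zero] at this

variable {A : Set F} {θ : E} (hθ : ∀ a ∈ A, θ - algebraMap F E a ≠ 0)

/-- The map `K^M_*(F) ⊗ G → K^M_*(F) ⊗ Eˣ` defined by the evaluation at `θ` of split rational
functions. -/
noncomputable def evalTensor :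
    MilnorK F ⊗[ℤ] SplitUnits A →ₗ[MilnorK F] MilnorK F ⊗[ℤ] Additive Eˣ :=
  TensorProduct.AlgebraTensorModule.lTensor (MilnorK F) (MilnorK F)
    (splitEval θ hθ).toIntLinearMap

theorem evalTensor_tmul (x : MilnorK F) (g : SplitUnits A) :
    evalTensor hθ (x ⊗ₜ g) = x ⊗ₜ splitEval θ hθ g := rfl

theorem extendedAction_evalTensor (z : MilnorK F ⊗[ℤ] SplitUnits A) :
    extendedAction (algebraMap F E) (symbol E) (evalTensor hθ z) =
      extendedAction (algebraMap F E) (splitSymbol θ hθ) z := by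
  induction z using TensorProduct.induction_on with
  | zero => simp
  | add y z hy hz => simp only [map_add, hy, hz]
  | tmul x f => rfl

theorem evalTensor_mem_degreeTwo {z : MilnorK F ⊗[ℤ] SplitUnits A}
    (hz : z ∈ degreeTwo F (SplitUnits A)) : evalTensor hθ z ∈ degreeTwo F (Additive Eˣ) := by
  obtain ⟨s, rfl⟩ := hz
  induction s using TensorProduct.induction_on with
  | zero => simp
  | add y z hy hz =>
    rw [map_add, map_add]
    exact add_mem hy hz
  | tmul x f => exact ⟨x ⊗ₜ splitEval θ hθ f, rfl⟩

theorem evalTensor_mem_of_ratFunc_eq_zero (z : MilnorK F ⊗[ℤ] SplitUnits A)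
    (hz : extendedAction (algebraMap F (RatFunc F))
      (splitSymbol RatFunc.X ratFunc_X_sub_ne_zero) z = 0) :
    evalTensor hθ z ∈ quadraticRelations F E := by
  obtain ⟨w, rfl, hw⟩ := exists_const_of_extendedAction_ratFunc_eq_zero z hz
  have := mk_lTensor_eq_zero (E := E) w hw
  convert this using 1
  clear this hw hz
  induction w using TensorProduct.induction_on with
  | zero => simp
  | add y z hy hz => simp only [map_add, hy, hz]
  | tmul x f =>
    rw [LinearMap.lTensor_tmul, LinearMap.lTensor_tmul, evalTensor_tmul]
    congr 1
    exact splitEval_const θ hθ f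

/-- The ideal is spanned by products `r{n}` with `n(θ) = 1`, where `r` is an integer plus terms
`x{g}`. The integer part contributes `m ⊗ n`, which evaluates to zero. For `x{g}{n}` the universal
degree-two expression `s` of `{g}{n}` is used: at `θ` it becomes a relation, because `{n(θ)} = 0`.
-/
theorem exists_lift_of_mem_symbolIdeal {y : splitRing A}
    (hy : y ∈ symbolIdeal (splitEval θ hθ).ker) :
    ∃ z, extendedAction (algebraMap F (RatFunc F))
      (splitSymbol RatFunc.X ratFunc_X_sub_ne_zero) z = y ∧
      evalTensor hθ z ∈ quadraticRelations F E := by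
  induction hy using Submodule.closure_induction with
  | zero => exact ⟨0, by simp, by simp⟩
  | add x y _ _ hx hy =>
    obtain ⟨z, hz, hz'⟩ := hx
    obtain ⟨w, hw, hw'⟩ := hy
    exact ⟨z + w, by rw [map_add, hz, hw]; rfl, by rw [map_add]; exact add_mem hz' hw'⟩
  | smul_mem r x hx =>
    obtain ⟨n, hn, rfl⟩ := hx
    have hn0 : splitEval θ hθ n = 0 := hn
    obtain ⟨m, w, hr⟩ := exists_eq_int_add_of_mem_closure _ r.2
    rw [smul_eq_mul, Subring.coe_mul, hr, coe_splitRingSymbol, add_mul]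
    suffices h : ∃ z, extendedAction (algebraMap F (RatFunc F))
        (splitSymbol RatFunc.X ratFunc_X_sub_ne_zero) z =
        extendedAction (algebraMap F (RatFunc F)) (splitSymbol RatFunc.X ratFunc_X_sub_ne_zero) w *
          splitSymbol RatFunc.X ratFunc_X_sub_ne_zero n ∧
        evalTensor hθ z ∈ quadraticRelations F E by
      obtain ⟨z, hz, hz'⟩ := h
      refine ⟨(m : MilnorK F) ⊗ₜ n + z, ?_, ?_⟩
      · rw [map_add, hz, extendedAction_tmul, map_intCast]
      · rw [map_add, evalTensor_tmul, hn0, TensorProduct.tmul_zero, zero_add]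
        exact hz'
    clear hr
    induction w using TensorProduct.induction_on with
    | zero => exact ⟨0, by simp, by simp⟩
    | add x y hx hy =>
      obtain ⟨z, hz, hz'⟩ := hx
      obtain ⟨w, hw, hw'⟩ := hy
      exact ⟨z + w, by rw [map_add, map_add, hz, hw, add_mul],
        by rw [map_add]; exact add_mem hz' hw'⟩
    | tmul x g =>
      obtain ⟨s, hs, hsX, hsθ⟩ := exists_degreeTwo_eq_mul ratFunc_X_sub_ne_zero hθ g n
      refine ⟨x • s, by rw [extendedAction_smul, hsX, extendedAction_tmul, mul_assoc], ?_⟩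
      rw [map_smul]
      refine Submodule.smul_mem _ _ (Submodule.subset_span ⟨?_, evalTensor_mem_degreeTwo hθ hs⟩)
      have : splitSymbol θ hθ n = 0 := by
        rw [splitSymbol, AddMonoidHom.comp_apply, hn0, map_zero]
      rw [extendedAction_evalTensor, hsθ, this, mul_zero]

/-- Suppose that the elements of `Eˣ`, and the pairs of elements with sum `1`, are values at `θ` of
split rational functions. Then the relations between symbols in `K^M_*(E)` are quadratic. -/
theorem mem_quadraticRelations (hsurj : Function.Surjective (splitEval θ hθ))
    (hone : ∀ a b : Eˣ, (a : E) + b = 1 → ∃ g h : SplitUnits A,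
      splitEval θ hθ g = Additive.ofMul a ∧ splitEval θ hθ h = Additive.ofMul b ∧
      ((splitEval (RatFunc.X : RatFunc F) ratFunc_X_sub_ne_zero g).toMul : RatFunc F) +
        ((splitEval RatFunc.X ratFunc_X_sub_ne_zero h).toMul : RatFunc F) = 1)
    {z : MilnorK F ⊗[ℤ] Additive Eˣ} (hz : extendedAction (algebraMap F E) (symbol E) z = 0) :
    z ∈ quadraticRelations F E := by
  let q := Ideal.Quotient.mk (symbolIdeal (splitEval θ hθ).ker)
  -- The class of `{g}` depends only on `g(θ)`. By `hone` the Steinberg relations persist, so this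
  -- map extends to `Λ` on `K^M_*(E)`.
  let lam : Additive Eˣ →+ splitRing A ⧸ symbolIdeal (splitEval θ hθ).ker :=
    (splitEval θ hθ).liftOfRightInverse (Function.surjInv hsurj)
      (Function.rightInverse_surjInv hsurj)
      ⟨q.toAddMonoidHom.comp (splitRingSymbol A), fun n hn =>
        Ideal.Quotient.eq_zero_iff_mem.mpr (Ideal.subset_span ⟨n, hn, rfl⟩)⟩
  have hlam : ∀ g, lam (splitEval θ hθ g) = q (splitRingSymbol A g) := fun g =>
    AddMonoidHom.liftOfRightInverse_comp_apply _ _ _ _ g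
  let Λ : MilnorK E →+* splitRing A ⧸ symbolIdeal (splitEval θ hθ).ker := lift lam fun a b hab => by
    obtain ⟨g, h, hg, hh, hgh⟩ := hone a b hab
    rw [← hg, ← hh, hlam, hlam, ← map_mul]
    have : splitRingSymbol A g * splitRingSymbol A h = 0 := Subtype.ext
      (symbol_mul_symbol _ _ hgh)
    rw [this, map_zero]
  have hΛ : ∀ e, Λ (symbol E e) = lam e := lift_symbol _ _
  have hΛmap : ∀ x, Λ (map (algebraMap F E) x) = q (constHom A x) := fun x => by
    have : Λ.comp (map (algebraMap F E)) = q.comp (constHom A) := hom_ext fun f => by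
      rw [RingHom.comp_apply, RingHom.comp_apply, constHom_symbol, ← hlam, splitEval_const, ← hΛ]
      exact congrArg Λ (map_symbol _ f.toMul)
    exact DFunLike.congr_fun this x
  have hlift : ∀ t : MilnorK F ⊗[ℤ] SplitUnits A, ∃ r : splitRing A,
      (r : MilnorK (RatFunc F)) = extendedAction (algebraMap F (RatFunc F))
        (splitSymbol RatFunc.X ratFunc_X_sub_ne_zero) t ∧
      Λ (extendedAction (algebraMap F E) (symbol E) (evalTensor hθ t)) = q r := fun t => by
    induction t using TensorProduct.induction_on with
    | zero => exact ⟨0, by simp, by simp⟩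
    | add x y hx hy =>
      obtain ⟨r, hr, hr'⟩ := hx
      obtain ⟨s, hs, hs'⟩ := hy
      exact ⟨r + s, by rw [Subring.coe_add, hr, hs, map_add], by
        simp only [map_add, hr', hs']⟩
    | tmul x g =>
      refine ⟨constHom A x * splitRingSymbol A g, ?_, ?_⟩
      · rw [Subring.coe_mul, coe_constHom, extendedAction_tmul]
        rfl
      · rw [evalTensor_tmul, extendedAction_tmul, map_mul, hΛmap, hΛ, hlam, map_mul]
  obtain ⟨t, rfl⟩ : ∃ t, evalTensor hθ t = z := LinearMap.lTensor_surjective _ hsurj z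
  obtain ⟨r, hr, hr'⟩ := hlift t
  -- The image `r` of the lift `t` lies in the ideal of the kernel, hence has a second lift `w` with
  -- quadratic value at `θ`; then `t - w` is a relation already in `K^M_*(F(X))`.
  rw [hz, map_zero, eq_comm] at hr'
  obtain ⟨w, hw, hw'⟩ := exists_lift_of_mem_symbolIdeal hθ (Ideal.Quotient.eq_zero_iff_mem.mp hr')
  have h := evalTensor_mem_of_ratFunc_eq_zero hθ (t - w) (by rw [map_sub, hw, hr, sub_self])
  rw [map_sub] at h
  simpa using add_mem h hw'

theorem exists_eq_int_add (hsurj : Function.Surjective (splitEval θ hθ)) (y : MilnorK E) :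
    ∃ (n : ℤ) (z : MilnorK F ⊗[ℤ] Additive Eˣ),
      y = n + extendedAction (algebraMap F E) (symbol E) z := by
  have hr : Set.range (splitSymbol θ hθ) = Set.range (symbol E) := by
    rw [splitSymbol, AddMonoidHom.coe_comp, hsurj.range_comp]
  obtain ⟨n, z, hz⟩ := exists_eq_int_add_of_mem_closure hθ (y := y) (by
    rw [hr, closure_range_symbol]
    trivial)
  exact ⟨n, evalTensor hθ z, by rw [extendedAction_evalTensor, hz]⟩

end Main
end MilnorK

namespace MilnorK

/-! ### From tensors with `Eˣ` to tensors with the component of degree one -/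

section DegreeOne
variable {F : Type u} {E : Type v} [Field F] [Field E] [Algebra F E]

/-- The symbol of an element of `Eˣ`, in the component of degree one of `K^M_{≥1}(E)`. -/
noncomputable def Pos.symbol (F : Type u) (E : Type v) [Field F] [Field E] [Algebra F E] :
    Additive Eˣ →+ Pos.component F E 1 where
  toFun e := ⟨⟨MilnorK.symbol E e, HomogeneousIdeal.mem_irrelevant_of_mem (MilnorK.component E)
    Nat.one_pos (symbol_mem E e)⟩, symbol_mem E e⟩
  map_zero' := Subtype.ext (Subtype.ext (map_zero _))
  map_add' _ _ := Subtype.ext (Subtype.ext (map_add _ _ _))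

theorem Pos.incl_symbol (e : Additive Eˣ) :
    Pos.incl F E (Pos.symbol F E e : Pos F E) = MilnorK.symbol E e := rfl

theorem Pos.symbol_surjective : Function.Surjective (Pos.symbol F E) := by
  rintro ⟨x, hx⟩
  have h := Pos.mem_component.mp hx
  rw [MilnorK.component, pow_one] at h
  obtain ⟨e, he⟩ := h
  exact ⟨e, Subtype.ext (Pos.incl_injective F E he)⟩

/-- The map `K^M_*(F) ⊗ Eˣ → K^M_*(F) ⊗ K^M_1(E)`. -/
noncomputable def symbolTensor (F : Type u) (E : Type v) [Field F] [Field E] [Algebra F E] :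
    MilnorK F ⊗[ℤ] Additive Eˣ →ₗ[MilnorK F] MilnorK F ⊗[ℤ] Pos.component F E 1 :=
  TensorProduct.AlgebraTensorModule.lTensor (MilnorK F) (MilnorK F)
    (Pos.symbol F E).toIntLinearMap

theorem symbolTensor_surjective : Function.Surjective (symbolTensor F E) :=
  LinearMap.lTensor_surjective _ Pos.symbol_surjective

theorem incl_degreeOneAction_symbolTensor (z : MilnorK F ⊗[ℤ] Additive Eˣ) :
    Pos.incl F E (degreeOneAction (A := MilnorK F) (Pos.component F E) (symbolTensor F E z)) =
      extendedAction (algebraMap F E) (MilnorK.symbol E) z := by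
  induction z using TensorProduct.induction_on with
  | zero => simp
  | add y z hy hz => simp only [map_add, hy, hz]
  | tmul x e =>
    change Pos.incl F E (degreeOneAction (A := MilnorK F) (Pos.component F E)
      (x ⊗ₜ[ℤ] Pos.symbol F E e)) = _
    rw [degreeOneAction_tmul, Pos.incl_smul, Pos.incl_symbol, extendedAction_tmul]

theorem symbolTensor_mem_degreeTwo {z : MilnorK F ⊗[ℤ] Additive Eˣ}
    (hz : z ∈ degreeTwo F (Additive Eˣ)) : symbolTensor F E z ∈
      LinearMap.range (TensorProduct.map (component F 1).subtype
        (LinearMap.id (R := ℤ) (M := Pos.component F E 1))) := by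
  obtain ⟨s, rfl⟩ := hz
  induction s using TensorProduct.induction_on with
  | zero => simp
  | add y z hy hz =>
    rw [map_add, map_add]
    exact add_mem hy hz
  | tmul x e => exact ⟨x ⊗ₜ Pos.symbol F E e, rfl⟩

/-- Quadraticity of `K^M_{≥1}(E)` in terms of symbols. -/
theorem isQuadraticModule_of_quadraticRelations
    (hgen : ∀ y : MilnorK E, ∃ (n : ℤ) (z : MilnorK F ⊗[ℤ] Additive Eˣ),
      y = n + extendedAction (algebraMap F E) (MilnorK.symbol E) z)
    (hrel : ∀ z : MilnorK F ⊗[ℤ] Additive Eˣ,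
      extendedAction (algebraMap F E) (MilnorK.symbol E) z = 0 → z ∈ quadraticRelations F E) :
    IsQuadraticModule (R := ℤ) (MilnorK.component F) (Pos.component F E) where
  generated_in_degree_one := fun y => by
    obtain ⟨n, z, hz⟩ := hgen (Pos.incl F E y)
    set w := degreeOneAction (A := MilnorK F) (Pos.component F E) (symbolTensor F E z) with hw
    refine ⟨symbolTensor F E z, Pos.incl_injective F E ?_⟩
    rw [← hw]
    rw [← incl_degreeOneAction_symbolTensor, ← hw] at hz
    have hn : (n : MilnorK E) ∈ MilnorK.component E 0 := by
      rw [component_zero]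
      exact ⟨n, by simp⟩
    have hn' : (n : MilnorK E) = Pos.incl F E (y - w) := by
      rw [map_sub, hz, add_sub_cancel_right]
    -- The integer has degree zero but equals an element of the positive part, so it vanishes in
    -- `K^M_*(E)`.
    have h0 := Pos.component_zero (y - w) (Pos.mem_component.mpr (hn' ▸ hn))
    rw [sub_eq_zero.mp h0]
  relations_in_degree_two := by
    have hker : ∀ z, degreeOneAction (A := MilnorK F) (Pos.component F E)
        (symbolTensor F E z) = 0 ↔
        extendedAction (algebraMap F E) (MilnorK.symbol E) z = 0 := fun z => by
      rw [← incl_degreeOneAction_symbolTensor, map_eq_zero_iff _ (Pos.incl_injective F E)]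
    apply le_antisymm
    · intro t ht
      obtain ⟨z, rfl⟩ := symbolTensor_surjective t
      have hz := hrel z ((hker z).mp ht)
      rw [quadraticRelations] at hz
      have hmap := Submodule.mem_map_of_mem (f := symbolTensor F E) hz
      rw [Submodule.map_span] at hmap
      refine Submodule.span_mono ?_ hmap
      rintro _ ⟨s, ⟨hs, hs'⟩, rfl⟩
      exact ⟨(hker s).mpr hs, symbolTensor_mem_degreeTwo hs'⟩
    · rw [Submodule.span_le]
      exact fun z hz => hz.1

end DegreeOne

/-! ### Lifting elements of `Eˣ` and Steinberg pairs -/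

section Fractions
open Polynomial
variable {F : Type u} {E : Type v} [Field F] [Field E] [Algebra F E] [FiniteDimensional F E]

theorem val_toMul_sub {L : Type*} [Field L] (x y : Additive Lˣ) :
    ((x - y).toMul : L) = (x.toMul : L) / (y.toMul : L) :=
  Units.val_div_eq_div_val x.toMul y.toMul

/-- If all polynomials of degree at most `[E : F]/2` split, then any `e ∈ E = F(θ)` other than `0`
is the value at `θ` of a split rational function `g` such that, if `e ≠ 1`, then `1 - g` is split
as well. -/
theorem exists_splitEval_eq {θ : E} (hθ : IntermediateField.adjoin F {θ} = ⊤)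
    (hsplit : ∀ p : F[X], p.natDegree ≤ Module.finrank F E / 2 → p.Splits)
    {A : Set F} (hA : ∀ a, a ∈ A ↔ θ - algebraMap F E a ≠ 0) (a : Eˣ) :
    ∃ g : SplitUnits A, splitEval θ (fun x hx => (hA x).mp hx) g = Additive.ofMul a ∧
      ∀ b : Eˣ, (a : E) + b = 1 → ∃ h : SplitUnits A,
        splitEval θ (fun x hx => (hA x).mp hx) h = Additive.ofMul b ∧
        ((splitEval (RatFunc.X : RatFunc F) ratFunc_X_sub_ne_zero g).toMul : RatFunc F) +
          ((splitEval RatFunc.X ratFunc_X_sub_ne_zero h).toMul : RatFunc F) = 1 := by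
  set k := Module.finrank F E with hk
  have hkpos : 0 < k := Module.finrank_pos
  have hval : ∀ p : F[X], p ≠ 0 → p.natDegree ≤ k / 2 → aeval θ p ≠ 0 := fun p hp0 hp =>
    aeval_ne_zero_of_natDegree_lt hθ hp0 (by omega)
  have hex : ∀ p : F[X], p ≠ 0 → p.natDegree ≤ k / 2 → ∃ g : SplitUnits A,
      ((splitEval θ (fun x hx => (hA x).mp hx) g).toMul : E) = aeval θ p ∧
      ((splitEval (RatFunc.X : RatFunc F) ratFunc_X_sub_ne_zero g).toMul : RatFunc F) =
        aeval RatFunc.X p := fun p hp0 hp => by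
    -- A root of `p` outside `A` would equal `θ`, contradicting `p(θ) ≠ 0`.
    refine exists_splitEval_eq_aeval _ _ (hsplit p hp) hp0 fun a ha => ?_
    rw [hA, sub_ne_zero]
    rintro rfl
    refine hval p hp0 hp ?_
    rw [aeval_algebraMap_apply_eq_algebraMap_eval, ha.eq_zero, map_zero]
  obtain ⟨p, q, hp0, hq0, hp, hq, hpq⟩ := exists_fraction hθ a.ne_zero
  obtain ⟨gp, hgpθ, hgpX⟩ := hex p hp0 hp
  obtain ⟨gq, hgqθ, hgqX⟩ := hex q hq0 hq
  have hqθ := hval q hq0 hq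
  have hqX : aeval (RatFunc.X : RatFunc F) q ≠ 0 := hgqX ▸ Units.ne_zero _
  refine ⟨gp - gq, ?_, fun b hab => ?_⟩
  · refine Additive.toMul.injective (Units.ext ?_)
    rw [map_sub, val_toMul_sub, hgpθ, hgqθ, hpq, mul_div_cancel_right₀ _ hqθ]
    rfl
  -- With the common denominator `q`, the complement `1 - p/q` has numerator `q - p`, whose degree
  -- obeys the same bound.
  · have hr : aeval θ (q - p) = b * aeval θ q := by
      rw [map_sub, hpq]
      linear_combination -(aeval θ q) * hab
    have hr0 : q - p ≠ 0 := fun h => by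
      rw [h, map_zero, zero_eq_mul] at hr
      exact hr.elim b.ne_zero hqθ
    obtain ⟨gr, hgrθ, hgrX⟩ := hex (q - p) hr0 ((natDegree_sub_le q p).trans (max_le hq hp))
    refine ⟨gr - gq, ?_, ?_⟩
    · refine Additive.toMul.injective (Units.ext ?_)
      rw [map_sub, val_toMul_sub, hgrθ, hgqθ, hr,
        mul_div_cancel_right₀ _ hqθ]
      rfl
    · rw [map_sub _ gp gq, map_sub _ gr gq, val_toMul_sub, val_toMul_sub, hgpX, hgrX, hgqX, ← add_div, map_sub, add_sub_cancel,
        div_self hqX]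

end Fractions

end MilnorK

theorem theorem9 {F : Type u} {E : Type v} [Field F] [Field E] [Algebra F E]
    [FiniteDimensional F E] [Algebra.IsSeparable F E] (k : ℕ) (hk : Module.finrank F E = k)
    (hF : ∀ (L : Type u) [Field L] [Algebra F L] [FiniteDimensional F L],
      (Module.finrank F L : ℝ) ≤ (k : ℝ) / 2 → Module.finrank F L = 1) :
    IsQuadraticModule (R := ℤ) (MilnorK.component F) (MilnorK.Pos.component F E) := by
  obtain ⟨θ, hθ⟩ := Field.exists_primitive_element F E
  -- The admissible zeros are all of `F`, except `θ` itself when `θ ∈ F`, that is, when `k = 1`.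
  have hex := fun a => MilnorK.exists_splitEval_eq hθ
    (fun p hp => MilnorK.splits_of_natDegree_le hF (hk ▸ hp))
    (A := {a | θ - algebraMap F E a ≠ 0}) (fun _ => Iff.rfl) a
  have hsurj : Function.Surjective (MilnorK.splitEval θ
      (A := {a | θ - algebraMap F E a ≠ 0}) fun _ h => h) := fun a =>
    (hex a.toMul).imp fun _ hg => hg.1
  refine MilnorK.isQuadraticModule_of_quadraticRelations (MilnorK.exists_eq_int_add _ hsurj)
    fun z => MilnorK.mem_quadraticRelations _ hsurj fun a b hab => ?_
  obtain ⟨g, hg, hg'⟩ := hex a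
  obtain ⟨h, hh, hgh⟩ := hg' b hab
  exact ⟨g, h, hg, hh, hgh⟩
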